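/- All systems are finite-dimensional with fixed orthonormal bases; the system $A$ has dimension at least $1$. A state is a positive semi-definite operator of trace one, and a quantum channel is a completely positive trace-preserving linear map. For a linear map $\mathcal{N}_{A\to B}$, its Choi operator is $\Gamma^{\mathcal{N}}_{RB}:=(\mathrm{id}_R\otimes\mathcal{N})(|\Gamma\rangle\langle\Gamma|_{RA})$, where $R\cong A$ and $|\Gamma\rangle_{RA}=\sum_i|i\rangle_R|i\rangle_A$. The support of a Hermitian operator is the orthogonal complement of its kernel. For a state $\rho$, a positive semi-definite operator $\sigma$ and $\alpha\in(0,1)\cup(1,\infty)$, let $$\widehat{Q}_\alpha(\rho\Vert\sigma):=\lim_{\varepsilon\to0^+}\operatorname{Tr}\!\left[\sigma_\varepsilon\left(\sigma_\varepsilon^{-1/2}\rho\,\sigma_\varepsilon^{-1/2}\right)^{\alpha}\right]\in[0,\infty],\qquad \sigma_\varepsilon:=\sigma+\varepsilon I,$$ $$\widehat{D}_\alpha(\rho\Vert\sigma):=\frac{1}{\alpha-1}\ln\widehat{Q}_\alpha(\rho\Vert\sigma),$$ with $\ln 0=-\infty$ and $\ln(+\infty)=+\infty$. For channels $\mathcal{N}_{A\to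 B}$ and $\mathcal{M}_{A\to B}$ let $$\widehat{D}_\alpha(\mathcal{N}\Vert\mathcal{M}):=\sup_{\rho_{RA}}\widehat{D}_\alpha\big((\mathrm{id}_R\otimes\mathcal{N})(\rho_{RA})\,\Vert\,(\mathrm{id}_R\otimes\mathcal{M})(\rho_{RA})\big),$$ where the supremum is over all states $\rho_{RA}$ with a reference system $R$ of arbitrary finite dimension. For positive semi-definite $X$, $Y$ put $G_\alpha(X,Y):=X^{1/2}(X^{-1/2}YX^{-1/2})^{\alpha}X^{1/2}$, where here and below all inverses are taken on the support. **Proposition.** Let $\mathcal{N}_{A\to B}$ and $\mathcal{M}_{A\to B}$ be quantum channels and let $\alpha\in(0,1)\cup(1,2]$. Then $$\widehat{D}_\alpha(\mathcal{N}\Vert\mathcal{M})=\frac{1}{\alpha-1}\ln\widehat{Q}_\alpha(\mathcal{N}\Vert\mathcal{M}),$$ where $$\widehat{Q}_\alpha(\mathcal{N}\Vert\mathcal{M}):=\begin{cases}\lambda_{\min}\big(\operatorname{Tr}_B[G_\alpha(\Gamma^{\mathcal{M}}_{RB},\Gamma^{\mathcal{N}}_{RB})]\big)&\text{if }\alpha\in(0,1)\text{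 and }\operatorname{supp}\Gamma^{\mathcal{N}}_{RB}\subseteq\operatorname{supp}\Gamma^{\mathcal{M}}_{RB},\\[2pt]\big\Vert\operatorname{Tr}_B[G_\alpha(\Gamma^{\mathcal{M}}_{RB},\Gamma^{\mathcal{N}}_{RB})]\big\Vert_\infty&\text{if }\alpha\in(1,2]\text{ and }\operatorname{supp}\Gamma^{\mathcal{N}}_{RB}\subseteq\operatorname{supp}\Gamma^{\mathcal{M}}_{RB},\\[2pt]\lambda_{\min}\big(\operatorname{Tr}_B[G_\alpha(\Gamma^{\mathcal{M}}_{RB},\widetilde{\Gamma^{\mathcal{N}}_{RB}})]\big)&\text{if }\alpha\in(0,1)\text{ and }\operatorname{supp}\Gamma^{\mathcal{N}}_{RB}\not\subseteq\operatorname{supp}\Gamma^{\mathcal{M}}_{RB},\\[2pt]+\infty&\text{if }\alpha\in(1,2]\text{ and }\operatorname{supp}\Gamma^{\mathcal{N}}_{RB}\not\subseteq\operatorname{supp}\Gamma^{\mathcal{M}}_{RB}.\end{cases}$$ Here $\lambda_{\min}$ is the minimum eigenvalue, $\Vert\cdot\Vert_\infty$ is the operator norm, and $$\widetilde{\Gamma^{\mathcal{N}}_{RB}}:=\Pi\,\Gamma^{\mathcal{N}}_{RB}\,\Pi-\big(\Pi\,\Gamma^{\mathcal{N}}_{RB}\,\Pi^\perp\big)\big(\Pi^\perp\,\Gamma^{\mathcal{N}}_{RB}\,\Pi^\perp\big)^{-1}\big(\Pi\,\Gamma^{\mathcal{N}}_{RB}\,\Pi^\perp\big)^\dagger,$$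 where $\Pi$ is the orthogonal projection onto the support of $\Gamma^{\mathcal{M}}_{RB}$ and $\Pi^\perp$ the orthogonal projection onto its kernel. Moreover, for $\alpha\in(0,1)$, $$\widehat{Q}_\alpha(\mathcal{N}\Vert\mathcal{M})=\lim_{\varepsilon\to0^+}\lambda_{\min}\big(\operatorname{Tr}_B[G_\alpha(\Gamma^{\mathcal{M}}_{RB}+\varepsilon I_{RB},\Gamma^{\mathcal{N}}_{RB})]\big).$$ -/

import Mathlib

open Set Filter Topology
open scoped ENNReal Matrix ComplexOrder

noncomputable section

/-! Operators on a finite-dimensional Hilbert space with a fixed orthonormal basis indexed by `n`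
are matrices `Matrix n n ℂ`; a composite system has index type `R × A`. -/

/-- A density operator: positive semi-definite with unit trace. -/
def IsState {n : Type*} [Fintype n] (ρ : Matrix n n ℂ) : Prop :=
  ρ.PosSemidef ∧ ρ.trace = 1

/-- The map `id_R ⊗ Φ`, acting on an operator of the composite system `RA` blockwise. -/
def idTensor {R A B : Type*} (Φ : Matrix A A ℂ →ₗ[ℂ] Matrix B B ℂ)
    (X : Matrix (R × A) (R × A) ℂ) : Matrix (R × B) (R × B) ℂ :=
  Matrix.of fun p q => Φ (Matrix.of fun a a' => X (p.1, a) (q.1, a')) p.2 q.2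

/-- Complete positivity: `id_k ⊗ Φ` preserves positive semi-definiteness for all `k`. -/
def IsCompletelyPositive {A B : Type*} [Fintype A] [Fintype B]
    (Φ : Matrix A A ℂ →ₗ[ℂ] Matrix B B ℂ) : Prop :=
  ∀ (k : ℕ) (X : Matrix (Fin k × A) (Fin k × A) ℂ), X.PosSemidef → (idTensor Φ X).PosSemidef

/-- A quantum channel: a completely positive trace-preserving linear map. -/
def IsQuantumChannel {A B : Type*} [Fintype A] [Fintype B]
    (Φ : Matrix A A ℂ →ₗ[ℂ] Matrix B B ℂ) : Prop :=
  IsCompletelyPositive Φ ∧ ∀ X : Matrix A A ℂ, (Φ X).trace = X.trace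

/-- The unnormalized maximally entangled vector `∑ i, |i⟩|i⟩`. -/
def maxEntVec (A : Type*) [DecidableEq A] : A × A → ℂ :=
  fun p => if p.1 = p.2 then 1 else 0

/-- The Choi operator `(id_R ⊗ Φ)(|Γ⟩⟨Γ|)`, with `R` a copy of the input system. -/
def choi {A B : Type*} [DecidableEq A] (Φ : Matrix A A ℂ →ₗ[ℂ] Matrix B B ℂ) :
    Matrix (A × B) (A × B) ℂ :=
  idTensor Φ (Matrix.vecMulVec (maxEntVec A) (star (maxEntVec A)))

/-- Partial trace over the second factor. -/
def partialTraceRight {R B : Type*} [Fintype B] (X : Matrix (R × B) (R × B) ℂ) :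
    Matrix R R ℂ :=
  Matrix.of fun r r' => ∑ b, X (r, b) (r', b)

section FunctionsOfOperators

variable {n : Type*} [Fintype n] [DecidableEq n]

/-- The power `X ^ s` of a positive semi-definite operator by functional calculus. Since
`(0 : ℝ) ^ s = 0` for `s ≠ 0`, inverse powers are taken on the support of `X`. -/
def matPow (X : Matrix n n ℂ) (s : ℝ) : Matrix n n ℂ :=
  cfc (fun x : ℝ => x ^ s) X

/-- The support of a (Hermitian) operator: the orthogonal complement of its kernel. -/
def opSupp (X : Matrix n n ℂ) : Submodule ℂ (EuclideanSpace ℂ n) :=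
  (LinearMap.ker (Matrix.toEuclideanLin X))ᗮ

/-- The orthogonal projection onto the support. -/
def suppProj (X : Matrix n n ℂ) : Matrix n n ℂ :=
  Matrix.toEuclideanLin.symm (opSupp X).starProjection.toLinearMap

/-- The orthogonal projection onto the kernel, i.e. onto the complement of the support. -/
def kerProj (X : Matrix n n ℂ) : Matrix n n ℂ :=
  1 - suppProj X

/-- The weighted operator geometric mean `X^{1/2} (X^{-1/2} Y X^{-1/2})^α X^{1/2}`. -/
def geoMean (α : ℝ) (X Y : Matrix n n ℂ) : Matrix n n ℂ :=
  matPow X (1 / 2) * matPow (matPow X (-(1 / 2)) * Y * matPow X (-(1 / 2))) α * matPow X (1 / 2)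

/-- The Schur complement `Y₀₀ - Y₀₁ Y₁₁⁻¹ Y₀₁†`, for the blocks of `Y` relative to
`supp X ⊕ ker X`, with the inverse taken on the support. -/
def schurOnSupp (X Y : Matrix n n ℂ) : Matrix n n ℂ :=
  suppProj X * Y * suppProj X -
    (suppProj X * Y * kerProj X) * matPow (kerProj X * Y * kerProj X) (-1) *
      (suppProj X * Y * kerProj X)ᴴ

/-- The minimum eigenvalue of a Hermitian operator. -/
def minEigenvalue (X : Matrix n n ℂ) : ℝ :=
  sInf (spectrum ℝ X)

/-- The operator norm (largest singular value). -/
def opNormInf (X : Matrix n n ℂ) : ℝ :=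
  ‖Matrix.toEuclideanCLM (n := n) (𝕜 := ℂ) X‖

/-- The geometric Rényi relative quasi-entropy of a state and a positive semi-definite operator,
`lim_{ε → 0⁺} Tr[σ_ε (σ_ε^{-1/2} ρ σ_ε^{-1/2})^α]` with `σ_ε = σ + ε I`, the limit being taken
in `[0, ∞]`. -/
def geoRenyiQuasi (α : ℝ) (ρ σ : Matrix n n ℂ) : ℝ≥0∞ :=
  limUnder (𝓝[>] (0 : ℝ)) fun ε =>
    ENNReal.ofReal
      ((σ + (ε : ℂ) • 1) *
        matPow (matPow (σ + (ε : ℂ) • 1) (-(1 / 2)) * ρ *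
          matPow (σ + (ε : ℂ) • 1) (-(1 / 2))) α).trace.re

/-- The geometric Rényi relative entropy `(α - 1)⁻¹ ln Q`, with `ln 0 = -∞`, `ln ∞ = ∞`. -/
def geoRenyi (α : ℝ) (ρ σ : Matrix n n ℂ) : EReal :=
  (((α - 1)⁻¹ : ℝ) : EReal) * ENNReal.log (geoRenyiQuasi α ρ σ)

end FunctionsOfOperators

section Channels

variable {A B : Type*} [Fintype A] [DecidableEq A] [Fintype B] [DecidableEq B]

/-- The geometric Rényi relative entropy of channels: the supremum over all states `ρ_{RA}` with a
reference system `R` of arbitrary finite dimension. -/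
def geoRenyiChannel (α : ℝ) (N M : Matrix A A ℂ →ₗ[ℂ] Matrix B B ℂ) : EReal :=
  ⨆ (r : ℕ) (ρ : Matrix (Fin r × A) (Fin r × A) ℂ) (_ : IsState ρ),
    geoRenyi α (idTensor N ρ) (idTensor M ρ)

open Classical in
/-- The explicit expression for the quasi-entropy of channels in terms of Choi operators. -/
def choiQuasi (α : ℝ) (N M : Matrix A A ℂ →ₗ[ℂ] Matrix B B ℂ) : ℝ≥0∞ :=
  if opSupp (choi N) ≤ opSupp (choi M) then
    if α < 1 then
      ENNReal.ofReal (minEigenvalue (partialTraceRight (geoMean α (choi M) (choi N))))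
    else
      ENNReal.ofReal (opNormInf (partialTraceRight (geoMean α (choi M) (choi N))))
  else
    if α < 1 then
      ENNReal.ofReal (minEigenvalue (partialTraceRight
        (geoMean α (choi M) (schurOnSupp (choi M) (choi N)))))
    else ⊤

end Channels

end

open scoped MatrixOrder Kronecker

namespace Matrix

variable {m n : Type*}

/-! Write X, Y for the Choi operators of M, N, let Ỹ be the Schur complement of Y on supp X, and put
T = Tr_B G_α(X, Ỹ). When Y is supported in supp X, Ỹ = Y. The claim is that the channel divergence
optimizes Tr[F T] over input states F: the minimum eigenvalue for α < 1, the norm for α > 1. The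
power function is operator concave in the first range and operator convex in the second, so all
inequalities merely reverse. A sign s = ±1 carried through `SignedLE` treats both cases at once, and
the sign of 1/(α - 1) undoes the reversal at the end.

The engine is the transformer inequality `geoMean_transformer`: Σ K_i G(X, Y) K_i† ≤ G(X', Σ K_i Y
K_i†) whenever Σ K_i X K_i† ≤ X', up to the sign s and the projection onto supp X'. It follows from
the operator Jensen inequality `jensen_matPow`. Any input ρ_{RA} = C C† turns the channel outputs
into Σ (Z_k ⊗ 1) Γ (Z_k ⊗ 1)†, with Z_k the columns of C read as operators and F = Σ Z_k† Z_k a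
state. The transformer inequality then gives the upper bound on the divergence
(`geoRenyi_le_scaledLog`). For the lower bound take a pure input whose Z is invertible, so that the
inequality can be run backwards with Z⁻¹ (`exists_scaledLog_le_geoRenyi`). Other F follow by
continuity.

The remaining point is the limit ε → 0 in G(X + ε, Y), settled in trace by `tendsto_trace_geoMean`.
The operator K = P - Y₀₁ Y₁₁⁻¹ fixes X and sends Y to Ỹ, giving the main term, while the part on ker
X is of order ε^(1-α). That order vanishes for α < 1 and diverges for α > 1 when the supports are
not nested. -/

/-- The Loewner order up to a real factor: `s • (B - A)` is positive semi-definite. -/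
def SignedLE [Fintype n] (s : ℝ) (A B : Matrix n n ℂ) : Prop :=
  (s • (B - A)).PosSemidef

lemma PosSemidef.real_smul [Fintype n] {A : Matrix n n ℂ} (hA : A.PosSemidef) {r : ℝ}
    (hr : 0 ≤ r) : (r • A).PosSemidef := by
  have := hA.smul (a := (r : ℂ)) (by exact_mod_cast hr)
  simpa using this

lemma PosSemidef.trace_re_nonneg [Fintype n] {A : Matrix n n ℂ} (hA : A.PosSemidef) :
    0 ≤ A.trace.re :=
  (Complex.le_def.1 hA.trace_nonneg).1

/-! ### Loewner order with a sign. -/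

section Order

variable [Fintype n] [Fintype m] {s : ℝ} {A B C : Matrix n n ℂ}

lemma signedLE_one : SignedLE 1 A B ↔ A ≤ B := by
  rw [SignedLE, one_smul, le_iff]

lemma signedLE_neg_one : SignedLE (-1) A B ↔ B ≤ A := by
  rw [SignedLE, neg_one_smul, neg_sub, le_iff]

lemma SignedLE.trans (h₁ : SignedLE s A B) (h₂ : SignedLE s B C) : SignedLE s A C := by
  have := PosSemidef.add h₁ h₂
  rwa [← smul_add, add_comm, sub_add_sub_cancel] at this

lemma SignedLE.conj (h : SignedLE s A B) (K : Matrix m n ℂ) :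
    SignedLE s (K * A * Kᴴ) (K * B * Kᴴ) := by
  have := h.mul_mul_conjTranspose_same K
  simpa [SignedLE, Matrix.mul_sub, Matrix.sub_mul] using this

lemma SignedLE.trace_le (h : SignedLE s A B) : s * A.trace.re ≤ s * B.trace.re := by
  have := PosSemidef.trace_re_nonneg h
  simp [trace_smul, trace_sub, mul_sub] at this
  linarith

lemma conj_le (h : A ≤ B) (K : Matrix m n ℂ) : K * A * Kᴴ ≤ K * B * Kᴴ := by
  rw [← signedLE_one] at h ⊢
  exact h.conj K

lemma trace_re_mono (h : A ≤ B) : A.trace.re ≤ B.trace.re := by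
  simpa using (signedLE_one.2 h).trace_le

lemma real_smul_le (h : A ≤ B) {r : ℝ} (hr : 0 ≤ r) : r • A ≤ r • B := by
  rw [le_iff, ← smul_sub]
  exact PosSemidef.real_smul h hr

lemma real_smul_le_smul (hA : A.PosSemidef) {r t : ℝ} (hr : r ≤ t) : r • A ≤ t • A := by
  rw [le_iff, ← sub_smul]
  exact hA.real_smul (sub_nonneg.2 hr)

end Order

/-! ### Functional calculus on matrices and trace bounds. -/

section Cfc

variable [Fintype n] [DecidableEq n] [Fintype m] {A : Matrix n n ℂ}

lemma continuousOn_spectrum (A : Matrix n n ℂ) (f : ℝ → ℝ) : ContinuousOn f (spectrum ℝ A) :=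
  A.finite_real_spectrum.continuousOn f

lemma continuousOn_image_spectrum (A : Matrix n n ℂ) (f g : ℝ → ℝ) :
    ContinuousOn f (g '' spectrum ℝ A) :=
  (A.finite_real_spectrum.image g).continuousOn f

lemma cfc_mul_cfc (A : Matrix n n ℂ) (f g : ℝ → ℝ) :
    cfc f A * cfc g A = cfc (fun x => f x * g x) A :=
  (cfc_mul f g A (continuousOn_spectrum A f) (continuousOn_spectrum A g)).symm

lemma IsHermitian.cfc_cfc (hA : A.IsHermitian) (f g : ℝ → ℝ) :
    cfc g (cfc f A) = cfc (fun x => g (f x)) A :=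
  (cfc_comp' g f A (continuousOn_image_spectrum A g f) (continuousOn_spectrum A f)
    hA.isSelfAdjoint).symm

lemma isHermitian_cfc (f : ℝ → ℝ) (A : Matrix n n ℂ) : (cfc f A).IsHermitian :=
  cfc_predicate (p := IsSelfAdjoint) f A

lemma IsHermitian.cfc_self (hA : A.IsHermitian) : cfc (fun x : ℝ => x) A = A :=
  cfc_id' ℝ A hA.isSelfAdjoint

lemma PosSemidef.spectrum_nonneg (hA : A.PosSemidef) {x : ℝ} (hx : x ∈ spectrum ℝ A) : 0 ≤ x :=
  spectrum_nonneg_of_nonneg (nonneg_iff_posSemidef.2 hA) hx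

lemma PosSemidef.cfc_congr (hA : A.PosSemidef) {f g : ℝ → ℝ} (h : ∀ x, 0 ≤ x → f x = g x) :
    cfc f A = cfc g A :=
  _root_.cfc_congr fun _ hx => h _ (hA.spectrum_nonneg hx)

lemma PosSemidef.cfc_posSemidef (hA : A.PosSemidef) {f : ℝ → ℝ} (h : ∀ x, 0 ≤ x → 0 ≤ f x) :
    (cfc f A).PosSemidef :=
  nonneg_iff_posSemidef.1 (cfc_nonneg fun _ hx => h _ (hA.spectrum_nonneg hx))

/-- The weights are the squared moduli of the coordinates of x in an eigenbasis. They do not depend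
on f, so an integral over a family of functions can be taken scalar by scalar. -/
lemma IsHermitian.exists_cfc_dotProduct (hA : A.IsHermitian) (x : n → ℂ) :
    ∃ w : n → ℝ, ∀ f : ℝ → ℝ,
      (star x ⬝ᵥ (cfc f A *ᵥ x)).re = ∑ j, w j * f (hA.eigenvalues j) := by
  set U : Matrix n n ℂ := (hA.eigenvectorUnitary : Matrix n n ℂ)
  refine ⟨fun j => Complex.normSq ((star U *ᵥ x) j), fun f => ?_⟩
  have h1 : cfc f A = U * diagonal (fun j => ((f (hA.eigenvalues j) : ℝ) : ℂ)) * star U := by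
    rw [hA.cfc_eq, IsHermitian.cfc, Unitary.conjStarAlgAut_apply]
    rfl
  have h2 : star x ⬝ᵥ (cfc f A *ᵥ x) =
      star (star U *ᵥ x) ⬝ᵥ (diagonal (fun j => ((f (hA.eigenvalues j) : ℝ) : ℂ)) *ᵥ
        (star U *ᵥ x)) := by
    rw [h1, star_mulVec, ← dotProduct_mulVec, ← mulVec_mulVec, ← mulVec_mulVec]
    simp [star_eq_conjTranspose]
  rw [h2]
  simp only [dotProduct, mulVec_diagonal, Complex.re_sum]
  refine Finset.sum_congr rfl fun j _ => ?_
  simp [Complex.normSq_apply]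
  ring

lemma exists_pos_le_smul_one (hA : A.IsHermitian) :
    ∃ c : ℝ, 0 < c ∧ A ≤ c • (1 : Matrix n n ℂ) := by
  obtain ⟨c, hc⟩ := A.finite_real_spectrum.bddAbove
  refine ⟨max c 1, by positivity, ?_⟩
  have h := cfc_mono (a := A) (f := fun x : ℝ => x) (g := fun _ : ℝ => max c 1)
    (fun x hx => (hc hx).trans (le_max_left _ _)) (continuousOn_spectrum A _)
    (continuousOn_spectrum A _)
  rwa [hA.cfc_self, cfc_const _ A hA.isSelfAdjoint, Algebra.algebraMap_eq_smul_one] at h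

lemma trace_conj_le {K : Matrix m n ℂ} {c : ℝ} (h : Kᴴ * K ≤ c • (1 : Matrix n n ℂ))
    {D : Matrix n n ℂ} (hD : D.PosSemidef) : (K * D * Kᴴ).trace.re ≤ c * D.trace.re := by
  set R := cfc Real.sqrt D
  have hR : R * R = D := by
    rw [cfc_mul_cfc, hD.cfc_congr (fun x hx => Real.mul_self_sqrt hx), hD.1.cfc_self]
  have hRh : Rᴴ = R := isHermitian_cfc _ _
  have h1 := trace_re_mono (conj_le h R)
  have h2 : (R * (Kᴴ * K) * Rᴴ).trace = (K * D * Kᴴ).trace := by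
    rw [hRh, trace_mul_comm, ← Matrix.mul_assoc, ← Matrix.mul_assoc, hR, trace_mul_comm,
      ← Matrix.mul_assoc]
  rw [h2] at h1
  simpa [hRh, hR] using h1

/-- Traces of conjugates of a positive operator are dominated by its trace. -/
lemma exists_trace_conj_le (K : Matrix m n ℂ) :
    ∃ c : ℝ, 0 < c ∧ ∀ D : Matrix n n ℂ, D.PosSemidef →
      (K * D * Kᴴ).trace.re ≤ c * D.trace.re := by
  obtain ⟨c, hc, h⟩ := exists_pos_le_smul_one (isHermitian_conjTranspose_mul_self K)
  exact ⟨c, hc, fun D hD => trace_conj_le h hD⟩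

end Cfc

/-! ### Resolvents and the integrand of the integral representation of powers. -/

section Resolvent

variable {n : Type*} [Fintype n] [DecidableEq n] {A : Matrix n n ℂ} {t : ℝ}

lemma PosSemidef.cfc_resolvent (hA : A.PosSemidef) (ht : 0 < t) :
    cfc (fun x : ℝ => x / (t + x)) A = 1 - cfc (fun x : ℝ => t / (t + x)) A := by
  rw [eq_sub_iff_add_eq, ← cfc_add A _ _ (continuousOn_spectrum A _) (continuousOn_spectrum A _),
    hA.cfc_congr (g := fun _ => (1 : ℝ)), cfc_const _ A hA.1.isSelfAdjoint, map_one]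
  intro x hx
  field_simp
  ring

lemma PosSemidef.mul_cfc_resolvent (hA : A.PosSemidef) (ht : 0 < t) :
    A * cfc (fun x : ℝ => t / (t + x)) A = t • (1 - cfc (fun x : ℝ => t / (t + x)) A) := by
  nth_rw 1 [← hA.1.cfc_self]
  rw [cfc_mul_cfc, ← hA.cfc_resolvent ht, ← cfc_const_mul _ _ _ (continuousOn_spectrum A _)]
  exact hA.cfc_congr fun x hx => by ring

lemma PosSemidef.cfc_rpowIntegrand₀₁ (hA : A.PosSemidef) {p : ℝ} (hp : p ∈ Ioo (0 : ℝ) 1)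
    (ht : 0 < t) :
    cfc (Real.rpowIntegrand₀₁ p t) A = t ^ (p - 1) • cfc (fun x : ℝ => x / (t + x)) A := by
  rw [← cfc_const_mul _ _ _ (continuousOn_spectrum A _)]
  refine hA.cfc_congr fun x hx => ?_
  rw [Real.rpowIntegrand₀₁_eq_pow_div hp ht.le hx]
  ring

lemma PosSemidef.cfc_mul_rpowIntegrand₀₁ (hA : A.PosSemidef) {p : ℝ} (hp : p ∈ Ioo (0 : ℝ) 1)
    (ht : 0 < t) :
    cfc (fun x => x * Real.rpowIntegrand₀₁ p t x) A =
      t ^ (p - 1) • (A - t • cfc (fun x : ℝ => x / (t + x)) A) := by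
  nth_rw 2 [← hA.1.cfc_self]
  rw [← cfc_const_mul _ _ _ (continuousOn_spectrum A _),
    ← cfc_sub _ _ A (continuousOn_spectrum A _) (continuousOn_spectrum A _),
    ← cfc_const_mul _ _ _ (continuousOn_spectrum A _)]
  refine hA.cfc_congr fun x hx => ?_
  rw [Real.rpowIntegrand₀₁_eq_pow_div hp ht.le hx]
  field_simp
  ring

lemma PosSemidef.matPow_two (hA : A.PosSemidef) : matPow A 2 = A * A := by
  conv_rhs => rw [← hA.1.cfc_self, cfc_mul_cfc]
  exact hA.cfc_congr fun x _ => by rw [Real.rpow_two, sq]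

end Resolvent

lemma posSemidef_sum_conj {ι m n : Type*} [Fintype ι] [Fintype m] [Fintype n]
    {T : Matrix m m ℂ} (hT : T.PosSemidef) (V : ι → Matrix m n ℂ) :
    (∑ i, (V i)ᴴ * T * V i).PosSemidef :=
  posSemidef_sum _ fun i _ => hT.conjTranspose_mul_mul_same (V i)

/-! ### Operator Jensen inequality for powers. -/

section Jensen

variable {ι m n : Type*} [Fintype ι] [Fintype m] [DecidableEq m] [Fintype n] [DecidableEq n]

/-- Operator Jensen inequality for `x ↦ x / (t + x)`. -/
lemma jensen_resolvent {T : Matrix m m ℂ} (hT : T.PosSemidef) (V : ι → Matrix m n ℂ)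
    (hV : ∑ i, (V i)ᴴ * V i ≤ 1) {S : Matrix n n ℂ} (hTS : ∑ i, (V i)ᴴ * T * V i ≤ S)
    {t : ℝ} (ht : 0 < t) :
    ∑ i, (V i)ᴴ * cfc (fun x : ℝ => x / (t + x)) T * V i ≤ cfc (fun x : ℝ => x / (t + x)) S := by
  have hS : S.PosSemidef := by
    simpa using (posSemidef_sum_conj hT V).add (le_iff.1 hTS)
  set S₀ := ∑ i, (V i)ᴴ * T * V i with hSdef
  set W := cfc (fun x : ℝ => t / (t + x)) S
  set W₀ := cfc (fun x : ℝ => t / (t + x)) T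
  have hW : Wᴴ = W := isHermitian_cfc _ _
  have hW₀ : W₀ᴴ = W₀ := isHermitian_cfc _ _
  have hTW : T * W₀ = t • (1 - W₀) := hT.mul_cfc_resolvent ht
  have hWT : W₀ * T = t • (1 - W₀) := by
    simpa only [conjTranspose_mul, conjTranspose_smul, conjTranspose_sub, conjTranspose_one,
      star_trivial, hT.1.eq, hW₀] using congrArg conjTranspose hTW
  have hSW : S * W = t • (1 - W) := hS.mul_cfc_resolvent ht
  rw [hS.cfc_resolvent ht, hT.cfc_resolvent ht, le_iff]
  change (1 - W - ∑ i, (V i)ᴴ * (1 - W₀) * V i).PosSemidef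
  set c := (1 : Matrix n n ℂ) - ∑ i, (V i)ᴴ * V i
  have hterm (i : ι) : (V i * W - W₀ * V i)ᴴ * (T + t • 1) * (V i * W - W₀ * V i) =
      W * ((V i)ᴴ * T * V i) * W + t • ((1 - W) * ((V i)ᴴ * V i) * (1 - W))
        - t • ((V i)ᴴ * (1 - W₀) * V i) := by
    have e1 : (V i)ᴴ * W₀ * T = t • ((V i)ᴴ * (1 - W₀)) := by
      rw [Matrix.mul_assoc, hWT, Matrix.mul_smul]
    have e2 (Z : Matrix m n ℂ) : T * (W₀ * Z) = t • ((1 - W₀) * Z) := by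
      rw [← Matrix.mul_assoc, hTW, Matrix.smul_mul]
    simp only [conjTranspose_sub, conjTranspose_mul, hW, hW₀, Matrix.sub_mul, Matrix.mul_sub,
      Matrix.add_mul, Matrix.mul_add, Matrix.mul_smul, Matrix.smul_mul, Matrix.mul_one,
      Matrix.one_mul, e1,
      smul_sub]
    simp only [Matrix.mul_assoc, e2, Matrix.sub_mul, Matrix.mul_sub, smul_sub, Matrix.mul_smul,
      Matrix.one_mul]
    abel
  -- Completing the square: the deficit is a sum of three positive terms, accounting for the defect
  -- of Σ V†V from 1, the slack S - S₀, and the failure of V to intertwine the two resolvents.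
  have hid : t • (1 - W - ∑ i, (V i)ᴴ * (1 - W₀) * V i) =
      t • ((1 - W)ᴴ * c * (1 - W)) + Wᴴ * (S - S₀) * W +
        ∑ i, (V i * W - W₀ * V i)ᴴ * (T + t • 1) * (V i * W - W₀ * V i) := by
    simp only [hterm, Finset.sum_sub_distrib, Finset.sum_add_distrib, ← Finset.smul_sum,
      ← Finset.sum_mul, ← Finset.mul_sum, ← hSdef]
    have hSW' : W * S * W = t • (W * (1 - W)) := by
      rw [Matrix.mul_assoc, hSW, Matrix.mul_smul]
    simp only [c, hSW', conjTranspose_sub, conjTranspose_one, hW, smul_sub, Matrix.mul_sub,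
      Matrix.sub_mul, Matrix.mul_one, Matrix.one_mul]
    abel
  have hpos : (t • (1 - W - ∑ i, (V i)ᴴ * (1 - W₀) * V i)).PosSemidef := by
    rw [hid]
    refine (((PosSemidef.conjTranspose_mul_mul_same (le_iff.1 hV) _).real_smul ht.le).add
      (PosSemidef.conjTranspose_mul_mul_same (le_iff.1 hTS) _)).add
      (posSemidef_sum _ fun i _ => PosSemidef.conjTranspose_mul_mul_same ?_ _)
    exact hT.add (PosSemidef.one.real_smul ht.le)
  simpa [smul_smul, ht.ne'] using hpos.real_smul (inv_nonneg.2 ht.le)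

open MeasureTheory in
-- Tested on a vector, both sides are finite weighted sums of values of f at eigenvalues. The
-- inequality therefore integrates from the integrands g t to f without operator-valued integrals.
lemma signedLE_cfc_of_integral {T : Matrix m m ℂ} (hT : T.PosSemidef) {S : Matrix n n ℂ}
    (hS : S.PosSemidef) (V : ι → Matrix m n ℂ)
    {s : ℝ} {μ : Measure ℝ} {f : ℝ → ℝ} {g : ℝ → ℝ → ℝ}
    (hint : ∀ x, 0 ≤ x → IntegrableOn (fun t => g t x) (Ioi 0) μ)
    (hf : ∀ x, 0 ≤ x → f x = ∫ t in Ioi 0, g t x ∂μ)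
    (hg : ∀ t, 0 < t → SignedLE s (∑ i, (V i)ᴴ * cfc (g t) T * V i)
      (cfc (g t) S)) :
    SignedLE s (∑ i, (V i)ᴴ * cfc f T * V i) (cfc f S) := by
  have hH (f : ℝ → ℝ) : (s • (cfc f S - ∑ i, (V i)ᴴ * cfc f T * V i)).IsHermitian := by
    have h1 : (∑ i, (V i)ᴴ * cfc f T * V i).IsHermitian := by
      rw [IsHermitian, conjTranspose_sum]
      exact Finset.sum_congr rfl fun i _ =>
        (isHermitian_conjTranspose_mul_mul _ (isHermitian_cfc f T)).eq
    simp only [IsHermitian, conjTranspose_smul, conjTranspose_sub, h1.eq,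
      (isHermitian_cfc f S).eq, star_trivial]
  refine PosSemidef.of_dotProduct_mulVec_nonneg (hH f) fun x => ?_
  obtain ⟨w, hw⟩ := hS.1.exists_cfc_dotProduct x
  choose u hu using fun i => hT.1.exists_cfc_dotProduct (V i *ᵥ x)
  have hform (f : ℝ → ℝ) :
      (star x ⬝ᵥ ((s • (cfc f S - ∑ i, (V i)ᴴ * cfc f T * V i)) *ᵥ x)).re =
        s * (∑ j, w j * f (hS.1.eigenvalues j) -
          ∑ i, ∑ j, u i j * f (hT.1.eigenvalues j)) := by
    rw [← hw f]
    simp only [← hu]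
    simp only [smul_mulVec, sub_mulVec, sum_mulVec, dotProduct_smul, dotProduct_sub,
      dotProduct_sum, Complex.smul_re, Complex.sub_re, Complex.re_sum, smul_eq_mul]
    congr 2
    refine Finset.sum_congr rfl fun i _ => ?_
    rw [star_mulVec, ← dotProduct_mulVec, mulVec_mulVec, mulVec_mulVec, Matrix.mul_assoc]
  have him : (star x ⬝ᵥ ((s • (cfc f S - ∑ i, (V i)ᴴ * cfc f T * V i)) *ᵥ x)).im = 0 :=
    (hH f).im_star_dotProduct_mulVec_self x
  have hre : 0 ≤ (star x ⬝ᵥ ((s • (cfc f S - ∑ i, (V i)ᴴ * cfc f T * V i)) *ᵥ x)).re := by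
    have e1 := fun j => hint _ (hS.eigenvalues_nonneg j)
    have e2 := fun j => hint _ (hT.eigenvalues_nonneg j)
    rw [hform]
    simp only [hf _ (hS.eigenvalues_nonneg _), hf _ (hT.eigenvalues_nonneg _)]
    have i1 : IntegrableOn (fun t => ∑ j, w j * g t (hS.1.eigenvalues j)) (Ioi 0) μ :=
      integrable_finsetSum _ fun j _ => (e1 j).const_mul _
    have i2 (i : ι) : IntegrableOn (fun t => ∑ j, u i j * g t (hT.1.eigenvalues j)) (Ioi 0) μ :=
      integrable_finsetSum _ fun j _ => (e2 j).const_mul _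
    have hI : s * (∑ j, w j * ∫ t in Ioi 0, g t (hS.1.eigenvalues j) ∂μ -
          ∑ i, ∑ j, u i j * ∫ t in Ioi 0, g t (hT.1.eigenvalues j) ∂μ) =
        ∫ t in Ioi 0, s * (∑ j, w j * g t (hS.1.eigenvalues j) -
          ∑ i, ∑ j, u i j * g t (hT.1.eigenvalues j)) ∂μ := by
      rw [integral_const_mul, integral_sub i1 (integrable_finsetSum _ fun i _ => i2 i),
        integral_finsetSum _ fun j _ => (e1 j).const_mul _,
        integral_finsetSum _ fun i _ => i2 i]
      simp only [integral_const_mul]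
      congr 3
      ext i
      rw [integral_finsetSum _ fun j _ => (e2 j).const_mul _]
      simp only [integral_const_mul]
    rw [hI]
    refine setIntegral_nonneg measurableSet_Ioi fun t ht => ?_
    rw [← hform]
    exact (Complex.le_def.1 ((hg t ht).dotProduct_mulVec_nonneg x)).1
  exact Complex.le_def.2 ⟨hre, him.symm⟩

/-- The sign of an exponent: `1` on `(0, 1)`, where the power function is operator concave, and
`-1` on `(1, 2]`, where it is operator convex. -/
def IsExponentSign (α s : ℝ) : Prop :=
  (α ∈ Ioo (0 : ℝ) 1 ∧ s = 1) ∨ (α ∈ Ioc (1 : ℝ) 2 ∧ s = -1)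

lemma IsExponentSign.pos {α s : ℝ} (h : IsExponentSign α s) : 0 < α := by
  rcases h with ⟨h, -⟩ | ⟨h, -⟩
  · exact h.1
  · linarith [h.1]

/-- The slack between Σ V†TV and S is kept so that taking V = 1 yields operator monotonicity as
well. -/
lemma jensen_rpow_Ioo {T : Matrix m m ℂ} (hT : T.PosSemidef) (V : ι → Matrix m n ℂ)
    (hV : ∑ i, (V i)ᴴ * V i ≤ 1) {S : Matrix n n ℂ} (hTS : ∑ i, (V i)ᴴ * T * V i ≤ S)
    {α : ℝ} (hα : α ∈ Ioo (0 : ℝ) 1) :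
    ∑ i, (V i)ᴴ * matPow T α * V i ≤ matPow S α := by
  have hS : S.PosSemidef := by
    simpa using (posSemidef_sum_conj hT V).add (le_iff.1 hTS)
  rw [← signedLE_one]
  obtain ⟨μ, hμ⟩ := Real.exists_measure_rpow_eq_integral_rpowIntegrand₀₁ hα
  refine signedLE_cfc_of_integral hT hS V (fun x hx => (hμ x hx).1) (fun x hx => (hμ x hx).2)
    fun t ht => ?_
  rw [hT.cfc_rpowIntegrand₀₁ hα ht, hS.cfc_rpowIntegrand₀₁ hα ht, signedLE_one]
  simp only [Matrix.mul_smul, Matrix.smul_mul, ← Finset.smul_sum]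
  exact real_smul_le (jensen_resolvent hT V hV hTS ht) (by positivity)

/-- Write x^α = x · x^(α-1) and use x · x/(t + x) = x - t · x/(t + x). The linear term agrees on
both sides, and the concave resolvent term enters with a minus sign, which reverses the inequality.
-/
lemma jensen_rpow_Ioo_one_two {T : Matrix m m ℂ} (hT : T.PosSemidef) (V : ι → Matrix m n ℂ)
    (hV : ∑ i, (V i)ᴴ * V i ≤ 1) {α : ℝ} (hα : α ∈ Ioo (1 : ℝ) 2) :
    SignedLE (-1) (∑ i, (V i)ᴴ * matPow T α * V i) (matPow (∑ i, (V i)ᴴ * T * V i) α) := by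
  have hα' : α - 1 ∈ Ioo (0 : ℝ) 1 := ⟨by linarith [hα.1], by linarith [hα.2]⟩
  obtain ⟨μ, hμ⟩ := Real.exists_measure_rpow_eq_integral_rpowIntegrand₀₁ hα'
  refine signedLE_cfc_of_integral (g := fun t x => x * Real.rpowIntegrand₀₁ (α - 1) t x) hT
    (posSemidef_sum_conj hT V) V
    (fun x hx => (hμ x hx).1.const_mul x) (fun x hx => ?_) fun t ht => ?_
  · rw [MeasureTheory.integral_const_mul, ← (hμ x hx).2]
    nth_rw 2 [← Real.rpow_one x]
    rw [← Real.rpow_add' hx (by linarith [hα.1])]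
    ring_nf
  rw [hT.cfc_mul_rpowIntegrand₀₁ hα' ht,
    (posSemidef_sum_conj hT V).cfc_mul_rpowIntegrand₀₁ hα' ht, signedLE_neg_one]
  simp only [Matrix.mul_smul, Matrix.smul_mul, ← Finset.smul_sum]
  refine real_smul_le ?_ (by positivity)
  simp only [Matrix.mul_sub, Matrix.sub_mul, Finset.sum_sub_distrib, Matrix.mul_smul,
    Matrix.smul_mul,
    ← Finset.smul_sum]
  exact sub_le_sub_left (real_smul_le (jensen_resolvent hT V hV le_rfl ht) ht.le) _

/-- The endpoint α = 2 would need the integral representation at exponent 1, outside its range (0,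
1). Here a direct sum of squares does it. -/
lemma jensen_sq {T : Matrix m m ℂ} (hT : T.PosSemidef) (V : ι → Matrix m n ℂ)
    (hV : ∑ i, (V i)ᴴ * V i ≤ 1) :
    SignedLE (-1) (∑ i, (V i)ᴴ * matPow T 2 * V i) (matPow (∑ i, (V i)ᴴ * T * V i) 2) := by
  set S := ∑ i, (V i)ᴴ * T * V i with hSdef
  have hS : S.PosSemidef := posSemidef_sum_conj hT V
  rw [signedLE_neg_one, hT.matPow_two, hS.matPow_two, le_iff]
  have hid : ∑ i, (V i)ᴴ * (T * T) * V i - S * S =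
      Sᴴ * (1 - ∑ i, (V i)ᴴ * V i) * S + ∑ i, (T * V i - V i * S)ᴴ * (T * V i - V i * S) := by
    have hterm (i : ι) : (T * V i - V i * S)ᴴ * (T * V i - V i * S) =
        (V i)ᴴ * (T * T) * V i - ((V i)ᴴ * T * V i) * S - S * ((V i)ᴴ * T * V i)
          + S * ((V i)ᴴ * V i) * S := by
      simp only [conjTranspose_sub, conjTranspose_mul, hT.1.eq, hS.1.eq, Matrix.sub_mul,
        Matrix.mul_sub, Matrix.mul_assoc]
      abel
    simp only [hterm, Finset.sum_sub_distrib, Finset.sum_add_distrib, ← Finset.sum_mul,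
      ← Finset.mul_sum, ← hSdef, hS.1.eq, Matrix.mul_sub, Matrix.sub_mul, Matrix.mul_one]
    abel
  rw [hid]
  exact (PosSemidef.conjTranspose_mul_mul_same (le_iff.1 hV) S).add
    (posSemidef_sum _ fun i _ => posSemidef_conjTranspose_mul_self _)

/-- Operator Jensen inequality for power functions. -/
theorem jensen_matPow {T : Matrix m m ℂ} (hT : T.PosSemidef) (V : ι → Matrix m n ℂ)
    (hV : ∑ i, (V i)ᴴ * V i ≤ 1) {α s : ℝ} (h : IsExponentSign α s) :
    SignedLE s (∑ i, (V i)ᴴ * matPow T α * V i) (matPow (∑ i, (V i)ᴴ * T * V i) α) := by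
  rcases h with ⟨hα, rfl⟩ | ⟨hα, rfl⟩
  · exact signedLE_one.2 (jensen_rpow_Ioo hT V hV le_rfl hα)
  · rcases hα.2.eq_or_lt with rfl | h2
    · exact jensen_sq hT V hV
    · exact jensen_rpow_Ioo_one_two hT V hV ⟨hα.1, h2⟩

lemma matPow_mono {A B : Matrix n n ℂ} (hA : A.PosSemidef) (hAB : A ≤ B) {α : ℝ}
    (hα : α ∈ Ioo (0 : ℝ) 1) : matPow A α ≤ matPow B α := by
  simpa using jensen_rpow_Ioo hA (fun _ : Unit => (1 : Matrix n n ℂ)) (by simp) (S := B)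
    (by simpa using hAB) hα

end Jensen

/-! ### Support projections and powers on the support. -/

section Support

variable {n : Type*} [Fintype n] [DecidableEq n] {X Y : Matrix n n ℂ}

/-- With the geometric projection expressed as a spectral indicator, the identities between powers
and projections become scalar identities on the spectrum. -/
lemma suppProj_eq_cfc (hX : X.IsHermitian) :
    suppProj X = cfc (fun x : ℝ => if x = 0 then 0 else 1) X := by
  set P := cfc (fun x : ℝ => if x = 0 then 0 else 1) X with hP
  have hPX : P = cfc (fun x : ℝ => x⁻¹) X * X := by
    conv_rhs => rw [← hX.cfc_self, hX.cfc_cfc, cfc_mul_cfc]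
    rw [hP]
    congr 1
    ext x
    split_ifs with h <;> simp [h]
  have hXP : X * P = X := by
    nth_rw 1 [← hX.cfc_self]
    rw [hP, cfc_mul_cfc]
    conv_rhs => rw [← hX.cfc_self]
    congr 1
    ext x
    split_ifs with h <;> simp [h]
  rw [suppProj, LinearEquiv.symm_apply_eq]
  ext1 v
  change (opSupp X).starProjection v = toEuclideanLin P v
  refine Submodule.eq_starProjection_of_mem_of_inner_eq_zero ?_ ?_
  · rw [opSupp, Submodule.mem_orthogonal]
    intro u hu
    have hPu : toEuclideanLin P u = 0 := by
      rw [hPX, toLpLin_mul_same, LinearMap.comp_apply, LinearMap.mem_ker.1 hu, map_zero]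
    have hsym := isSymmetric_toEuclideanLin_iff.2
      (isHermitian_cfc (fun x : ℝ => if x = 0 then 0 else 1) X)
    rw [← hsym u v, ← hP, hPu, inner_zero_left]
  · intro w hw
    rw [opSupp, Submodule.mem_orthogonal] at hw
    refine hw _ ?_
    rw [LinearMap.mem_ker, map_sub, ← LinearMap.comp_apply, ← toLpLin_mul_same, hXP, sub_self]

lemma isHermitian_matPow (X : Matrix n n ℂ) (s : ℝ) : (matPow X s).IsHermitian :=
  isHermitian_cfc _ _

lemma PosSemidef.posSemidef_matPow (hX : X.PosSemidef) (s : ℝ) : (matPow X s).PosSemidef :=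
  hX.cfc_posSemidef fun _ hx => Real.rpow_nonneg hx s

lemma isHermitian_suppProj (hX : X.IsHermitian) : (suppProj X).IsHermitian := by
  rw [suppProj_eq_cfc hX]
  exact isHermitian_cfc _ _

lemma PosSemidef.matPow_mul_matPow (hX : X.PosSemidef) {s t : ℝ} (hst : s + t ≠ 0) :
    matPow X s * matPow X t = matPow X (s + t) := by
  rw [matPow, matPow, cfc_mul_cfc]
  exact hX.cfc_congr fun x hx => (Real.rpow_add' hx hst).symm

lemma PosSemidef.matPow_mul_matPow_neg (hX : X.PosSemidef) {s : ℝ} (hs : s ≠ 0) :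
    matPow X s * matPow X (-s) = suppProj X := by
  rw [matPow, matPow, cfc_mul_cfc, suppProj_eq_cfc hX.1]
  refine hX.cfc_congr fun x hx => ?_
  rcases hx.eq_or_lt with rfl | hx
  · simp [Real.zero_rpow hs]
  · rw [if_neg hx.ne', ← Real.rpow_add hx, add_neg_cancel, Real.rpow_zero]

lemma PosSemidef.matPow_mul_suppProj (hX : X.PosSemidef) {s : ℝ} (hs : s ≠ 0) :
    matPow X s * suppProj X = matPow X s := by
  rw [matPow, suppProj_eq_cfc hX.1, cfc_mul_cfc]
  refine hX.cfc_congr fun x hx => ?_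
  rcases hx.eq_or_lt with rfl | hx
  · simp [Real.zero_rpow hs]
  · rw [if_neg hx.ne', mul_one]

lemma PosSemidef.suppProj_mul_matPow (hX : X.PosSemidef) {s : ℝ} (hs : s ≠ 0) :
    suppProj X * matPow X s = matPow X s := by
  simpa [(isHermitian_suppProj hX.1).eq, (isHermitian_matPow X s).eq] using
    congrArg Matrix.conjTranspose (hX.matPow_mul_suppProj hs)

lemma PosSemidef.matPow_one (hX : X.PosSemidef) : matPow X 1 = X := by
  conv_rhs => rw [← hX.1.cfc_self]
  exact hX.cfc_congr fun x _ => Real.rpow_one x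

lemma PosSemidef.mul_suppProj (hX : X.PosSemidef) : X * suppProj X = X := by
  simpa [hX.matPow_one] using hX.matPow_mul_suppProj one_ne_zero

lemma PosSemidef.suppProj_mul (hX : X.PosSemidef) : suppProj X * X = X := by
  simpa [hX.matPow_one] using hX.suppProj_mul_matPow one_ne_zero

lemma suppProj_mul_self (hX : X.IsHermitian) : suppProj X * suppProj X = suppProj X := by
  rw [suppProj_eq_cfc hX, cfc_mul_cfc]
  congr 1
  ext x
  split_ifs <;> simp

lemma PosSemidef.half_mul_half (hX : X.PosSemidef) :
    matPow X (1 / 2) * matPow X (1 / 2) = X := by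
  rw [hX.matPow_mul_matPow (by norm_num)]
  norm_num [hX.matPow_one]

lemma PosSemidef.half_mul_neg_half (hX : X.PosSemidef) :
    matPow X (1 / 2) * matPow X (-(1 / 2)) = suppProj X :=
  hX.matPow_mul_matPow_neg (by norm_num)

lemma PosSemidef.neg_half_mul_half (hX : X.PosSemidef) :
    matPow X (-(1 / 2)) * matPow X (1 / 2) = suppProj X := by
  simpa using hX.matPow_mul_matPow_neg (s := -(1 / 2)) (by norm_num)

lemma PosDef.suppProj_eq_one (hX : X.PosDef) : suppProj X = 1 := by
  have h := hX.posSemidef.mul_suppProj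
  exact hX.isUnit.mul_left_cancel (by rw [h, Matrix.mul_one])

lemma suppProj_le_one (hX : X.IsHermitian) : suppProj X ≤ 1 := by
  have h : (1 - suppProj X)ᴴ * (1 - suppProj X) = 1 - suppProj X := by
    simp [(isHermitian_suppProj hX).eq, Matrix.sub_mul, Matrix.mul_sub, suppProj_mul_self hX]
  rw [le_iff, ← h]
  exact posSemidef_conjTranspose_mul_self _

lemma PosSemidef.exists_suppProj_le (hX : X.PosSemidef) : ∃ c : ℝ, 0 < c ∧ suppProj X ≤ c • X := by
  obtain ⟨c, hc⟩ := (X.finite_real_spectrum.image fun x => x⁻¹).bddAbove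
  refine ⟨max c 1, by positivity, ?_⟩
  have h := cfc_mono (a := X) (f := fun x : ℝ => if x = 0 then 0 else 1)
    (g := fun x : ℝ => max c 1 * x) (fun x hx => ?_) (continuousOn_spectrum X _)
    (continuousOn_spectrum X _)
  · rwa [← suppProj_eq_cfc hX.1, cfc_const_mul _ _ _ (continuousOn_spectrum X _),
      hX.1.cfc_self] at h
  · have hx0 := hX.spectrum_nonneg hx
    split_ifs with h0
    · simp [h0]
    · have h1 : x⁻¹ ≤ max c 1 := (hc ⟨x, hx, rfl⟩).trans (le_max_left _ _)
      calc (1 : ℝ) = x⁻¹ * x := (inv_mul_cancel₀ h0).symm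
        _ ≤ max c 1 * x := mul_le_mul_of_nonneg_right h1 hx0

/-- Turns nested supports into an algebraic identity, the form used in the rest of the proof. -/
lemma opSupp_le_opSupp_iff (hX : X.PosSemidef) :
    opSupp Y ≤ opSupp X ↔ Y * suppProj X = Y := by
  rw [opSupp, opSupp, Submodule.orthogonal_le_orthogonal_iff]
  constructor
  · intro h
    apply toEuclideanLin.injective
    ext1 v
    have h1 : toEuclideanLin (1 - suppProj X) v ∈ LinearMap.ker (toEuclideanLin X) := by
      rw [LinearMap.mem_ker, ← LinearMap.comp_apply, ← toLpLin_mul_same, Matrix.mul_sub,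
        hX.mul_suppProj, Matrix.mul_one, sub_self, map_zero, LinearMap.zero_apply]
    have h2 := LinearMap.mem_ker.1 (h h1)
    rw [← LinearMap.comp_apply, ← toLpLin_mul_same, Matrix.mul_sub, Matrix.mul_one, map_sub,
      LinearMap.sub_apply, sub_eq_zero] at h2
    exact h2.symm
  · intro h v hv
    have hP : suppProj X = matPow X (-1) * X := by
      have := hX.matPow_mul_matPow_neg (s := -1) (by norm_num)
      rwa [neg_neg, hX.matPow_one, eq_comm] at this
    rw [LinearMap.mem_ker] at hv ⊢
    rw [← h, hP, toLpLin_mul_same, toLpLin_mul_same, LinearMap.comp_apply, LinearMap.comp_apply,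
      hv, map_zero, map_zero]

lemma PosSemidef.matPow_smul (hX : X.PosSemidef) {r : ℝ} (hr : 0 ≤ r) (s : ℝ) :
    matPow (r • X) s = r ^ s • matPow X s := by
  rw [matPow, matPow, ← cfc_const_mul _ _ _ (continuousOn_spectrum X _),
    ← cfc_comp_const_mul _ _ _ (continuousOn_image_spectrum X _ _) hX.1.isSelfAdjoint]
  exact hX.cfc_congr fun x hx => Real.mul_rpow hr hx

lemma PosSemidef.suppProj_smul (hX : X.PosSemidef) {r : ℝ} (hr : 0 < r) :
    suppProj (r • X) = suppProj X := by
  rw [← (hX.real_smul hr.le).half_mul_neg_half, hX.matPow_smul hr.le, hX.matPow_smul hr.le,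
    Matrix.smul_mul, Matrix.mul_smul, smul_smul, ← Real.rpow_add hr, add_neg_cancel,
    Real.rpow_zero, one_smul, hX.half_mul_neg_half]

end Support

/-! ### The weighted geometric mean and its transformer inequality. -/

section GeoMean

variable {ι m n : Type*} [Fintype ι] [Fintype m] [DecidableEq m] [Fintype n] [DecidableEq n]
  {X Y : Matrix n n ℂ} {X' : Matrix m m ℂ} {α s : ℝ}

lemma PosSemidef.matPow_conj (hY : Y.PosSemidef) (X : Matrix n n ℂ) (t : ℝ) :
    (matPow X t * Y * matPow X t).PosSemidef := by
  have := hY.mul_mul_conjTranspose_same (matPow X t)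
  rwa [(isHermitian_matPow X t).eq] at this

lemma PosSemidef.posSemidef_geoMean (hY : Y.PosSemidef) (α : ℝ) (X : Matrix n n ℂ) :
    (geoMean α X Y).PosSemidef :=
  ((hY.matPow_conj X _).posSemidef_matPow α).matPow_conj X _

/-- The transformer inequality for the weighted geometric mean. -/
theorem geoMean_transformer (h : IsExponentSign α s) (hX : X.PosSemidef) (hY : Y.PosSemidef)
    (hYX : Y * suppProj X = Y) (hX' : X'.PosSemidef) (K : ι → Matrix m n ℂ)
    (hK : ∑ i, K i * X * (K i)ᴴ ≤ X') :
    SignedLE s (∑ i, suppProj X' * (K i * geoMean α X Y * (K i)ᴴ) * suppProj X')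
      (geoMean α X' (∑ i, K i * Y * (K i)ᴴ)) := by
  set H := matPow X (1 / 2)
  set J := matPow X (-(1 / 2))
  set H' := matPow X' (1 / 2)
  set J' := matPow X' (-(1 / 2))
  have hH : Hᴴ = H := isHermitian_matPow _ _
  have hH' : H'ᴴ = H' := isHermitian_matPow _ _
  have hJ' : J'ᴴ = J' := isHermitian_matPow _ _
  have hPY : suppProj X * Y = Y := by
    simpa [(isHermitian_suppProj hX.1).eq, hY.1.eq] using congrArg conjTranspose hYX
  -- Chosen so that Σ V†V = X'^(-1/2) (Σ K X K†) X'^(-1/2) ≤ 1, while V†(X^(-1/2) Y X^(-1/2))V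
  -- restores X'^(-1/2) K Y K† X'^(-1/2). Jensen conjugated by X'^(1/2) is then the claim.
  let V : ι → Matrix n m ℂ := fun i => H * (K i)ᴴ * J'
  have hVs (i : ι) : (V i)ᴴ = J' * K i * H := by
    simp [V, hH, hJ', Matrix.mul_assoc]
  have hJX : J' * X' * J' = suppProj X' := by
    nth_rw 1 [← hX'.half_mul_half]
    rw [← Matrix.mul_assoc J', hX'.neg_half_mul_half, Matrix.mul_assoc,
      hX'.half_mul_neg_half, suppProj_mul_self hX'.1]
  have hV : ∑ i, (V i)ᴴ * V i ≤ 1 := by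
    have e : ∑ i, (V i)ᴴ * V i = J' * (∑ i, K i * X * (K i)ᴴ) * J'ᴴ := by
      rw [Finset.mul_sum, Finset.sum_mul]
      refine Finset.sum_congr rfl fun i _ => ?_
      rw [hVs, ← hX.half_mul_half, hJ']
      simp only [V, H, Matrix.mul_assoc]
    rw [e]
    refine (conj_le hK J').trans ?_
    rw [hJ', hJX]
    exact suppProj_le_one hX'.1
  have hmid : ∑ i, (V i)ᴴ * (J * Y * J) * V i = J' * (∑ i, K i * Y * (K i)ᴴ) * J' := by
    rw [Finset.mul_sum, Finset.sum_mul]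
    refine Finset.sum_congr rfl fun i _ => ?_
    have e : H * (J * Y * J) * H = Y := by
      have : H * (J * Y * J) * H = (H * J) * Y * (J * H) := by simp only [Matrix.mul_assoc]
      rw [this, hX.half_mul_neg_half, hX.neg_half_mul_half, hPY, hYX]
    have : (V i)ᴴ * (J * Y * J) * V i = J' * (K i * (H * (J * Y * J) * H) * (K i)ᴴ) * J' := by
      rw [hVs]
      simp only [V, Matrix.mul_assoc]
    rw [this, e]
  have hjen := (jensen_matPow (hY.matPow_conj X (-(1 / 2))) V hV h).conj H'
  rw [hmid, hH'] at hjen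
  have hlhs : H' * (∑ i, (V i)ᴴ * matPow (J * Y * J) α * V i) * H' =
      ∑ i, suppProj X' * (K i * geoMean α X Y * (K i)ᴴ) * suppProj X' := by
    rw [Finset.mul_sum, Finset.sum_mul]
    refine Finset.sum_congr rfl fun i _ => ?_
    rw [hVs]
    have : H' * (J' * K i * H * matPow (J * Y * J) α * V i) * H' =
        (H' * J') * (K i * (H * matPow (J * Y * J) α * H) * (K i)ᴴ) * (J' * H') := by
      simp only [V, Matrix.mul_assoc]
    rw [this, hX'.half_mul_neg_half, hX'.neg_half_mul_half]
    rfl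
  rwa [hlhs] at hjen

lemma geoMean_transformer_posDef (h : IsExponentSign α s) (hX : X.PosSemidef)
    (hY : Y.PosSemidef) (hYX : Y * suppProj X = Y) (hX' : X'.PosDef) (K : ι → Matrix m n ℂ)
    (hK : ∑ i, K i * X * (K i)ᴴ ≤ X') :
    SignedLE s (∑ i, K i * geoMean α X Y * (K i)ᴴ)
      (geoMean α X' (∑ i, K i * Y * (K i)ᴴ)) := by
  simpa [hX'.suppProj_eq_one] using geoMean_transformer h hX hY hYX hX'.posSemidef K hK

lemma geoMean_transformer_single (h : IsExponentSign α s) (hX : X.PosSemidef)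
    (hY : Y.PosSemidef) (hYX : Y * suppProj X = Y) (hX' : X'.PosDef) (K : Matrix m n ℂ)
    (hK : K * X * Kᴴ ≤ X') :
    SignedLE s (K * geoMean α X Y * Kᴴ) (geoMean α X' (K * Y * Kᴴ)) := by
  simpa using geoMean_transformer_posDef h hX hY hYX hX' (fun _ : Unit => K) (by simpa using hK)

lemma geoMean_smul_left (hX : X.PosSemidef) (hY : Y.PosSemidef) (α : ℝ) {r : ℝ} (hr : 0 < r) :
    geoMean α (r • X) Y = r ^ (1 - α) • geoMean α X Y := by
  rw [geoMean, hX.matPow_smul hr.le, hX.matPow_smul hr.le]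
  have h1 : r ^ (-(1 / 2) : ℝ) • matPow X (-(1 / 2)) * Y * r ^ (-(1 / 2) : ℝ) •
      matPow X (-(1 / 2)) = r ^ (-1 : ℝ) • (matPow X (-(1 / 2)) * Y * matPow X (-(1 / 2))) := by
    rw [Matrix.smul_mul, Matrix.smul_mul, Matrix.mul_smul, smul_smul, ← Real.rpow_add hr]
    norm_num
  rw [h1, (hY.matPow_conj X _).matPow_smul (by positivity), geoMean]
  simp only [Matrix.smul_mul, Matrix.mul_smul, smul_smul]
  rw [← Real.rpow_mul hr.le, ← Real.rpow_add hr, ← Real.rpow_add hr]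
  congr 2
  ring

lemma geoMean_mono_right {Y' : Matrix n n ℂ} (hY : Y.PosSemidef) (hYY' : Y ≤ Y')
    (hα : α ∈ Ioo (0 : ℝ) 1) (X : Matrix n n ℂ) : geoMean α X Y ≤ geoMean α X Y' := by
  have h1 := conj_le hYY' (matPow X (-(1 / 2)))
  rw [(isHermitian_matPow X _).eq] at h1
  have h2 := conj_le (matPow_mono (hY.matPow_conj X _) h1 hα) (matPow X (1 / 2))
  rwa [(isHermitian_matPow X _).eq] at h2

lemma geoMean_one_left (α : ℝ) (Y : Matrix n n ℂ) : geoMean α 1 Y = matPow Y α := by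
  have h1 (t : ℝ) : matPow (1 : Matrix n n ℂ) t = 1 := by
    simp [matPow, cfc_apply_one]
  simp [geoMean, h1]

/-- Supplies the positive coefficient of ε^(1-α) in the divergent case. -/
lemma geoMean_one_left_trace_pos (hY : Y.PosSemidef) (hY0 : Y ≠ 0) (hα : 0 < α) :
    0 < (geoMean α 1 Y).trace.re := by
  have hpsd := hY.posSemidef_matPow α
  rw [geoMean_one_left]
  refine lt_of_le_of_ne hpsd.trace_re_nonneg fun h => hY0 ?_
  have htr : (matPow Y α).trace = 0 :=
    Complex.ext h.symm (Complex.le_def.1 hpsd.trace_nonneg).2.symm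
  have hzero := hpsd.trace_eq_zero_iff.1 htr
  have : matPow (matPow Y α) α⁻¹ = Y := by
    rw [matPow, matPow, hY.1.cfc_cfc]
    conv_rhs => rw [← hY.1.cfc_self]
    refine hY.cfc_congr fun x hx => ?_
    rw [← Real.rpow_mul hx, mul_inv_cancel₀ hα.ne', Real.rpow_one]
  rw [← this, hzero, matPow, cfc_apply_zero, Real.zero_rpow (inv_ne_zero hα.ne'), map_zero]

end GeoMean

lemma PosSemidef.posDef_add_smul_one {n : Type*} [DecidableEq n]
    {X : Matrix n n ℂ} (hX : X.PosSemidef) {ε : ℝ} (hε : 0 < ε) :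
    (X + ε • (1 : Matrix n n ℂ)).PosDef := by
  have : (ε • (1 : Matrix n n ℂ)).PosDef := by
    have := (PosDef.one (n := n) (R := ℂ)).smul (a := (ε : ℂ)) (by exact_mod_cast hε)
    simpa using this
  exact PosDef.posSemidef_add hX this

/-! ### Schur complement relative to supp X ⊕ ker X. -/

section Regularization

variable {n : Type*} [Fintype n] [DecidableEq n] {X Y : Matrix n n ℂ} {α s : ℝ}

lemma isHermitian_kerProj (hX : X.IsHermitian) : (kerProj X).IsHermitian :=
  isHermitian_one.sub (isHermitian_suppProj hX)

lemma kerProj_mul_self (hX : X.IsHermitian) : kerProj X * kerProj X = kerProj X := by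
  simp [kerProj, Matrix.sub_mul, Matrix.mul_sub, suppProj_mul_self hX]

lemma kerProj_mul_suppProj (hX : X.IsHermitian) : kerProj X * suppProj X = 0 := by
  simp [kerProj, Matrix.sub_mul, suppProj_mul_self hX]

lemma PosSemidef.kerProj_mul (hX : X.PosSemidef) : kerProj X * X = 0 := by
  simp [kerProj, Matrix.sub_mul, hX.suppProj_mul]

lemma suppProj_add_kerProj (X : Matrix n n ℂ) : suppProj X + kerProj X = 1 := by
  simp [kerProj]

lemma kerProj_le_one (hX : X.IsHermitian) : kerProj X ≤ 1 := by
  rw [le_iff, kerProj, sub_sub_cancel]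
  have := posSemidef_conjTranspose_mul_self (suppProj X)
  rwa [(isHermitian_suppProj hX).eq, suppProj_mul_self hX] at this

lemma mul_kerProj_eq_zero_iff : Y * kerProj X = 0 ↔ Y * suppProj X = Y := by
  rw [kerProj, Matrix.mul_sub, Matrix.mul_one, sub_eq_zero, eq_comm]

/-- A positive operator annihilates `W` as soon as `Wᴴ Y W = 0`. -/
lemma PosSemidef.mul_eq_zero_of_conj {m : Type*} [Fintype m] (hY : Y.PosSemidef)
    {W : Matrix n m ℂ} (h : Wᴴ * Y * W = 0) : Y * W = 0 := by
  have hH := (isHermitian_matPow Y (1 / 2)).eq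
  have h1 : (matPow Y (1 / 2) * W)ᴴ * (matPow Y (1 / 2) * W) = 0 := by
    rw [conjTranspose_mul, hH, ← h]
    conv_rhs => rw [← hY.half_mul_half]
    simp only [Matrix.mul_assoc]
  rw [conjTranspose_mul_self_eq_zero] at h1
  rw [← hY.half_mul_half, Matrix.mul_assoc, h1, Matrix.mul_zero]

/-- The block `Y₁₁` of `Y` on the kernel of `X`. -/
noncomputable def kerBlock (X Y : Matrix n n ℂ) : Matrix n n ℂ :=
  kerProj X * Y * kerProj X

/-- The operator `K = P - Y₀₁ Y₁₁⁻¹` with `K Y K†` the Schur complement. -/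
noncomputable def schurOp (X Y : Matrix n n ℂ) : Matrix n n ℂ :=
  suppProj X - suppProj X * Y * kerProj X * matPow (kerBlock X Y) (-1)

lemma PosSemidef.posSemidef_kerBlock (hX : X.PosSemidef) (hY : Y.PosSemidef) :
    (kerBlock X Y).PosSemidef := by
  have := hY.mul_mul_conjTranspose_same (kerProj X)
  rwa [(isHermitian_kerProj hX.1).eq] at this

lemma kerProj_mul_matPow_kerBlock (hX : X.PosSemidef) (hY : Y.PosSemidef) :
    kerProj X * matPow (kerBlock X Y) (-1) = matPow (kerBlock X Y) (-1) := by
  have hD := hX.posSemidef_kerBlock hY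
  have h : kerProj X * suppProj (kerBlock X Y) = suppProj (kerBlock X Y) := by
    have h1 := hD.matPow_mul_matPow_neg one_ne_zero
    rw [hD.matPow_one] at h1
    rw [← h1, ← Matrix.mul_assoc]
    congr 1
    rw [kerBlock, ← Matrix.mul_assoc, ← Matrix.mul_assoc, kerProj_mul_self hX.1]
  rw [← hD.suppProj_mul_matPow (s := -1) (by norm_num), ← Matrix.mul_assoc, h]

lemma matPow_kerBlock_mul_kerProj (hX : X.PosSemidef) (hY : Y.PosSemidef) :
    matPow (kerBlock X Y) (-1) * kerProj X = matPow (kerBlock X Y) (-1) := by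
  simpa [(isHermitian_matPow _ _).eq, (isHermitian_kerProj hX.1).eq] using
    congrArg conjTranspose (kerProj_mul_matPow_kerBlock hX hY)

lemma matPow_kerBlock_mul_suppProj (hX : X.PosSemidef) (hY : Y.PosSemidef) :
    matPow (kerBlock X Y) (-1) * suppProj X = 0 := by
  rw [← matPow_kerBlock_mul_kerProj hX hY, Matrix.mul_assoc, kerProj_mul_suppProj hX.1,
    Matrix.mul_zero]

lemma offBlock_conjTranspose (hX : X.PosSemidef) (hY : Y.PosSemidef) :
    (suppProj X * Y * kerProj X)ᴴ = kerProj X * Y * suppProj X := by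
  simp [(isHermitian_suppProj hX.1).eq, (isHermitian_kerProj hX.1).eq, hY.1.eq, Matrix.mul_assoc]

lemma suppProj_mul_schurOp (hX : X.PosSemidef) (Y : Matrix n n ℂ) :
    suppProj X * schurOp X Y = schurOp X Y := by
  simp [schurOp, Matrix.mul_sub, ← Matrix.mul_assoc, suppProj_mul_self hX.1]

lemma schurOp_mul (hX : X.PosSemidef) (hY : Y.PosSemidef) : schurOp X Y * X = X := by
  rw [schurOp, Matrix.sub_mul, hX.suppProj_mul, Matrix.mul_assoc,
    ← matPow_kerBlock_mul_kerProj hX hY, Matrix.mul_assoc (matPow _ _), hX.kerProj_mul]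
  simp

/-- `schurOp X Y` acts as the identity on supp X, so its defect from 1 sees only ker X, where the
regularized mean is controlled. -/
lemma one_sub_schurOp_mul_kerProj (hX : X.PosSemidef) (hY : Y.PosSemidef) :
    (1 - schurOp X Y) * kerProj X = 1 - schurOp X Y := by
  have h : (1 - schurOp X Y) * suppProj X = 0 := by
    rw [schurOp, Matrix.sub_mul, Matrix.sub_mul, suppProj_mul_self hX.1,
      Matrix.mul_assoc _ _ (suppProj X),
      matPow_kerBlock_mul_suppProj hX hY]
    simp
  rw [kerProj, Matrix.mul_sub, h, Matrix.mul_one, sub_zero]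

lemma schurOp_conj (hX : X.PosSemidef) (hY : Y.PosSemidef) :
    schurOp X Y * Y * (schurOp X Y)ᴴ = schurOnSupp X Y := by
  have hD := hX.posSemidef_kerBlock hY
  set D := kerBlock X Y with hDdef
  set E := matPow D (-1)
  have hE : Eᴴ = E := isHermitian_matPow _ _
  have hEDE : E * D * E = E := by
    have h1 := hD.matPow_mul_matPow_neg one_ne_zero
    rw [hD.matPow_one] at h1
    rw [Matrix.mul_assoc, h1, hD.matPow_mul_suppProj (by norm_num)]
  have hE1 : E * kerProj X = E := matPow_kerBlock_mul_kerProj hX hY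
  have hE2 : kerProj X * E = E := kerProj_mul_matPow_kerBlock hX hY
  have hEE (Z : Matrix n n ℂ) : E * (Y * (E * Z)) = E * Z := by
    have : E * Y * E = E := by
      calc E * Y * E = (E * kerProj X) * Y * (kerProj X * E) := by rw [hE1, hE2]
        _ = E * D * E := by simp only [hDdef, kerBlock, Matrix.mul_assoc]
        _ = E := hEDE
    rw [← Matrix.mul_assoc, ← Matrix.mul_assoc, this]
  have hQE (Z : Matrix n n ℂ) : kerProj X * (E * Z) = E * Z := by rw [← Matrix.mul_assoc, hE2]
  have hEQ (Z : Matrix n n ℂ) : E * (kerProj X * Z) = E * Z := by rw [← Matrix.mul_assoc, hE1]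
  have hK : schurOp X Y = suppProj X - suppProj X * Y * kerProj X * E := rfl
  have hS : schurOnSupp X Y = suppProj X * Y * suppProj X -
    (suppProj X * Y * kerProj X) * E * (suppProj X * Y * kerProj X)ᴴ := rfl
  rw [hK, hS, conjTranspose_sub, conjTranspose_mul, offBlock_conjTranspose hX hY, hE,
    (isHermitian_suppProj hX.1).eq]
  simp only [Matrix.sub_mul, Matrix.mul_sub, Matrix.mul_assoc, hQE, hEQ, hEE]
  abel

lemma PosSemidef.posSemidef_schurOnSupp (hX : X.PosSemidef) (hY : Y.PosSemidef) :
    (schurOnSupp X Y).PosSemidef := by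
  rw [← schurOp_conj hX hY]
  exact hY.mul_mul_conjTranspose_same _

lemma schurOnSupp_mul_suppProj (hX : X.PosSemidef) (hY : Y.PosSemidef) :
    schurOnSupp X Y * suppProj X = schurOnSupp X Y := by
  rw [schurOnSupp, offBlock_conjTranspose hX hY]
  simp only [Matrix.sub_mul, Matrix.mul_assoc, suppProj_mul_self hX.1]

lemma schurOnSupp_eq_self (hX : X.PosSemidef) (hY : Y.PosSemidef) (h : Y * suppProj X = Y) :
    schurOnSupp X Y = Y := by
  have h1 := mul_kerProj_eq_zero_iff.2 h
  have h2 : suppProj X * Y = Y := by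
    simpa [(isHermitian_suppProj hX.1).eq, hY.1.eq] using congrArg conjTranspose h
  simp [schurOnSupp, h2, h1, h]

lemma schurOnSupp_le (hX : X.PosSemidef) (hY : Y.PosSemidef) : schurOnSupp X Y ≤ Y := by
  have hD := hX.posSemidef_kerBlock hY
  set D := kerBlock X Y with hDdef
  set E := matPow D (-1)
  set B := suppProj X * Y * kerProj X
  have hE : Eᴴ = E := isHermitian_matPow _ _
  have hDE : D * E = suppProj D := by
    have h1 := hD.matPow_mul_matPow_neg one_ne_zero
    rwa [hD.matPow_one] at h1
  have hED : E * D = suppProj D := by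
    simpa [hE, hD.1.eq, (isHermitian_suppProj hD.1).eq] using congrArg conjTranspose hDE
  have hEDE : E * D * E = E := by
    rw [Matrix.mul_assoc, hDE, hD.matPow_mul_suppProj (by norm_num)]
  -- Positivity of Y forces the off-diagonal block to vanish on the kernel of the block D, so the
  -- generalized inverse behaves like a true one here.
  have hB : B * (E * D) = B := by
    have h0 : (kerProj X * (1 - suppProj D))ᴴ * Y * (kerProj X * (1 - suppProj D)) = 0 := by
      have : (kerProj X * (1 - suppProj D))ᴴ * Y * (kerProj X * (1 - suppProj D)) =
          (1 - suppProj D)ᴴ * (D * (1 - suppProj D)) := by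
        rw [conjTranspose_mul, (isHermitian_kerProj hX.1).eq, hDdef, kerBlock]
        simp only [Matrix.mul_assoc]
      rw [this, Matrix.mul_sub, hD.mul_suppProj, Matrix.mul_one, sub_self, Matrix.mul_zero]
    have h1 := hY.mul_eq_zero_of_conj h0
    have h2 : B * (1 - suppProj D) = 0 := by
      rw [show B * (1 - suppProj D) = suppProj X * (Y * (kerProj X * (1 - suppProj D))) by
        simp only [B, Matrix.mul_assoc], h1, Matrix.mul_zero]
    rw [Matrix.mul_sub, Matrix.mul_one, sub_eq_zero] at h2
    rw [hED, ← h2]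
  have hB' : (E * D)ᴴ * Bᴴ = Bᴴ := by rw [← conjTranspose_mul, hB]
  have hB'' : D * (E * Bᴴ) = Bᴴ := by
    rw [conjTranspose_mul, hE, hD.1.eq] at hB'
    rw [← Matrix.mul_assoc, hB']
  have hEDEB : E * (D * (E * Bᴴ)) = E * Bᴴ := by rw [hB'']
  have hdec : Y = suppProj X * Y * suppProj X + B + Bᴴ + D := by
    have : Y = (suppProj X + kerProj X) * Y * (suppProj X + kerProj X) := by
      rw [suppProj_add_kerProj, Matrix.one_mul, Matrix.mul_one]
    rw [offBlock_conjTranspose hX hY, hDdef, kerBlock]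
    nth_rw 1 [this]
    simp only [B, Matrix.add_mul, Matrix.mul_add]
    abel
  have hS : schurOnSupp X Y = suppProj X * Y * suppProj X - B * E * Bᴴ := rfl
  rw [le_iff]
  have hid : Y - schurOnSupp X Y = (B * E + 1) * D * (B * E + 1)ᴴ := by
    rw [hS]
    nth_rw 1 [hdec]
    simp only [conjTranspose_add, conjTranspose_mul, hE, conjTranspose_one, Matrix.add_mul,
      Matrix.mul_add, Matrix.one_mul, Matrix.mul_one, Matrix.mul_assoc, hB, hB'']
    abel
  rw [hid]
  exact hD.mul_mul_conjTranspose_same _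

end Regularization

/-! ### The limit ε → 0 of the regularized mean. -/

section Limits

variable {n : Type*} [Fintype n] [DecidableEq n] {X Y : Matrix n n ℂ} {α s : ℝ}

/-- The transformer inequality for `G_α(X, Ỹ)` with `Ỹ` the Schur complement of `Y` on the
support of `X`. -/
lemma geoMean_schur_transformer {ι m : Type*} [Fintype ι] [Fintype m] [DecidableEq m]
    {X' : Matrix m m ℂ} (h : IsExponentSign α s) (hX : X.PosSemidef) (hY : Y.PosSemidef)
    (hα : α < 1 ∨ Y * suppProj X = Y) (hX' : X'.PosDef) (K : ι → Matrix m n ℂ)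
    (hK : ∑ i, K i * X * (K i)ᴴ ≤ X') :
    SignedLE s (∑ i, K i * geoMean α X (schurOnSupp X Y) * (K i)ᴴ)
      (geoMean α X' (∑ i, K i * Y * (K i)ᴴ)) := by
  have h1 := geoMean_transformer_posDef h hX (hX.posSemidef_schurOnSupp hY)
    (schurOnSupp_mul_suppProj hX hY) hX' K hK
  by_cases hS : Y * suppProj X = Y
  · rwa [schurOnSupp_eq_self hX hY hS] at h1 ⊢
  · have hα1 : α < 1 := hα.resolve_right hS
    obtain ⟨hα, rfl⟩ : α ∈ Ioo (0 : ℝ) 1 ∧ s = 1 := by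
      rcases h with h | ⟨h, -⟩
      · exact h
      · exact absurd h.1 hα1.not_gt
    -- For α < 1 the mean increases in its second argument, and the Schur complement lies below Y.
    refine h1.trans (signedLE_one.2 (geoMean_mono_right ?_ ?_ hα X'))
    · exact posSemidef_sum _ fun i _ =>
        (hX.posSemidef_schurOnSupp hY).mul_mul_conjTranspose_same (K i)
    · exact Finset.sum_le_sum fun i _ => conj_le (schurOnSupp_le hX hY) (K i)

lemma geoMean_schur_signedLE (h : IsExponentSign α s) (hX : X.PosSemidef) (hY : Y.PosSemidef)
    (hα : α < 1 ∨ Y * suppProj X = Y) {ε : ℝ} (hε : 0 < ε) :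
    SignedLE s (geoMean α X (schurOnSupp X Y)) (geoMean α (X + ε • 1) Y) := by
  have := geoMean_schur_transformer h hX hY hα (hX.posDef_add_smul_one hε)
    (fun _ : Unit => (1 : Matrix n n ℂ)) (by
      simpa [le_iff] using (PosSemidef.one (n := n) (R := ℂ)).real_smul hε.le)
  simpa using this

/-- Since K X K† = X and the range of K lies in supp X, K(X + ε)K† = X + ε K K† ≤ (1 + cε) X. The
transformer inequality and homogeneity in the first argument give the bound. -/
lemma schurOp_conj_geoMean (h : IsExponentSign α s) (hX : X.PosSemidef) (hY : Y.PosSemidef) :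
    ∃ c : ℝ, 0 < c ∧ ∀ ε : ℝ, 0 < ε →
      SignedLE s (schurOp X Y * geoMean α (X + ε • 1) Y * (schurOp X Y)ᴴ)
        ((1 + c * ε) ^ (1 - α) • geoMean α X (schurOnSupp X Y)) := by
  set K := schurOp X Y
  obtain ⟨c₁, hc₁, h₁⟩ := exists_pos_le_smul_one (isHermitian_mul_conjTranspose_self K)
  obtain ⟨c₂, hc₂, h₂⟩ := hX.exists_suppProj_le
  have hP := (isHermitian_suppProj hX.1).eq
  have hPK : suppProj X * K = K := suppProj_mul_schurOp hX Y
  have hKP : Kᴴ * suppProj X = Kᴴ := by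
    simpa [hP] using congrArg conjTranspose hPK
  have hKK : K * Kᴴ ≤ (c₁ * c₂) • X := by
    have := conj_le h₁ (suppProj X)
    rw [hP, ← Matrix.mul_assoc, hPK, Matrix.mul_assoc, hKP, Matrix.mul_smul, Matrix.mul_one,
      Matrix.smul_mul, suppProj_mul_self hX.1] at this
    rw [mul_smul]
    exact this.trans (real_smul_le h₂ hc₁.le)
  refine ⟨c₁ * c₂, by positivity, fun ε hε => ?_⟩
  have hr : 0 < 1 + c₁ * c₂ * ε := by positivity
  have hXε := hX.posDef_add_smul_one hε
  have hKX : K * (X + ε • 1) * Kᴴ ≤ (1 + c₁ * c₂ * ε) • X := by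
    have e : K * X * Kᴴ = X := by
      have h1 : K * X = X := schurOp_mul hX hY
      have h2 : X * Kᴴ = X := by simpa [hX.1.eq] using congrArg conjTranspose h1
      rw [h1, h2]
    rw [Matrix.mul_add, Matrix.add_mul, e, Matrix.mul_smul, Matrix.mul_one, Matrix.smul_mul,
      add_smul, one_smul, mul_comm _ ε, mul_smul]
    exact add_le_add_right (real_smul_le hKK hε.le) X
  have := geoMean_transformer h hXε.posSemidef hY
    (by rw [hXε.suppProj_eq_one, Matrix.mul_one]) (hX.real_smul hr.le) (fun _ : Unit => K)
    (by simpa using hKX)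
  simp only [Finset.univ_unique, Finset.sum_singleton, hX.suppProj_smul hr] at this
  rw [schurOp_conj hX hY, geoMean_smul_left hX (hX.posSemidef_schurOnSupp hY) α hr,
    Matrix.mul_assoc _ _ (suppProj X), Matrix.mul_assoc _ Kᴴ, hKP, ← Matrix.mul_assoc,
    ← Matrix.mul_assoc, hPK] at this
  exact this

/-- On ker X the regularized operator is just ε, so the scale is ε^(1-α). This bounds the error from
above for α < 1 and forces divergence from below for α > 1. -/
lemma kerProj_conj_geoMean (h : IsExponentSign α s) (hX : X.PosSemidef) (hY : Y.PosSemidef)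
    {ε : ℝ} (hε : 0 < ε) :
    SignedLE s (kerProj X * geoMean α (X + ε • 1) Y * kerProj X)
      (ε ^ (1 - α) • geoMean α 1 (kerBlock X Y)) := by
  have hXε := hX.posDef_add_smul_one hε
  have hQ := (isHermitian_kerProj hX.1).eq
  have hD : (ε • (1 : Matrix n n ℂ)).PosDef := by
    simpa using (PosSemidef.zero (n := n) (R := ℂ)).posDef_add_smul_one hε
  have := geoMean_transformer_single h hXε.posSemidef hY
    (by rw [hXε.suppProj_eq_one, Matrix.mul_one]) hD (kerProj X) (by
      rw [hQ, Matrix.mul_add, hX.kerProj_mul, zero_add, Matrix.mul_smul, Matrix.mul_one,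
        Matrix.smul_mul, kerProj_mul_self hX.1]
      exact real_smul_le (kerProj_le_one hX.1) hε.le)
  rw [hQ, show kerProj X * Y * kerProj X = kerBlock X Y from rfl,
    geoMean_smul_left PosSemidef.one (hX.posSemidef_kerBlock hY) α hε] at this
  exact this

lemma PosSemidef.trace_proj_conj_le {P : Matrix n n ℂ} (hP : P.IsHermitian) (hPP : P * P = P)
    (hP1 : P ≤ 1) {G : Matrix n n ℂ} (hG : G.PosSemidef) :
    (P * G * P).trace.re ≤ G.trace.re := by
  have := trace_conj_le (K := P) (c := 1) (by rwa [hP.eq, hPP, one_smul]) hG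
  rwa [hP.eq, one_mul] at this

/-- A weighted triangle inequality for congruences by a decomposition of the identity. -/
lemma PosSemidef.trace_le_of_add_eq_one {K R G : Matrix n n ℂ} (hG : G.PosSemidef)
    (hKR : K + R = 1) {δ : ℝ} (hδ : 0 < δ) :
    G.trace.re ≤ (1 + δ) * (K * G * Kᴴ).trace.re + (1 + δ⁻¹) * (R * G * Rᴴ).trace.re := by
  have h := (hG.mul_mul_conjTranspose_same (δ • K - R)).trace_re_nonneg
  have e1 : G.trace.re = (K * G * Kᴴ).trace.re + (K * G * Rᴴ).trace.re
      + (R * G * Kᴴ).trace.re + (R * G * Rᴴ).trace.re := by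
    have : G = (K + R) * G * (K + R)ᴴ := by simp [hKR]
    nth_rw 1 [this]
    simp only [conjTranspose_add, Matrix.add_mul, Matrix.mul_add, trace_add, Complex.add_re]
    ring
  have e2 : ((δ • K - R) * G * (δ • K - R)ᴴ).trace.re =
      δ * δ * (K * G * Kᴴ).trace.re - δ * (K * G * Rᴴ).trace.re
        - δ * (R * G * Kᴴ).trace.re + (R * G * Rᴴ).trace.re := by
    simp only [conjTranspose_sub, conjTranspose_smul, star_trivial, Matrix.sub_mul,
      Matrix.mul_sub, Matrix.smul_mul, Matrix.mul_smul, trace_sub, trace_smul, Complex.sub_re,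
      Complex.smul_re, smul_eq_mul]
    ring
  rw [e2] at h
  have h' := mul_nonneg (inv_nonneg.2 hδ.le) h
  have e3 : δ⁻¹ * (δ * δ * (K * G * Kᴴ).trace.re - δ * (K * G * Rᴴ).trace.re
        - δ * (R * G * Kᴴ).trace.re + (R * G * Rᴴ).trace.re) =
      δ * (K * G * Kᴴ).trace.re - (K * G * Rᴴ).trace.re - (R * G * Kᴴ).trace.re
        + δ⁻¹ * (R * G * Rᴴ).trace.re := by
    field_simp
  rw [e3] at h'
  rw [e1]
  linarith

lemma tendsto_one_add_mul_rpow (c p : ℝ) :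
    Tendsto (fun ε : ℝ => (1 + c * ε) ^ p) (𝓝[>] 0) (𝓝 1) := by
  have : ContinuousAt (fun ε : ℝ => (1 + c * ε) ^ p) 0 :=
    ContinuousAt.rpow_const (by fun_prop) (Or.inl (by simp))
  simpa using this.tendsto.mono_left nhdsWithin_le_nhds

lemma tendsto_rpow_nhdsGT_zero {p : ℝ} (hp : 0 < p) :
    Tendsto (fun ε : ℝ => ε ^ p) (𝓝[>] 0) (𝓝 0) := by
  simpa [Real.zero_rpow hp.ne'] using
    ((Real.continuousAt_rpow_const 0 p (Or.inr hp.le)).tendsto.mono_left nhdsWithin_le_nhds)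

/-- Convergence in trace of the regularized geometric mean. -/
theorem tendsto_trace_geoMean (h : IsExponentSign α s) (hX : X.PosSemidef) (hY : Y.PosSemidef)
    (hα : α < 1 ∨ Y * suppProj X = Y) :
    Tendsto (fun ε : ℝ => (geoMean α (X + ε • 1) Y).trace.re) (𝓝[>] 0)
      (𝓝 (geoMean α X (schurOnSupp X Y)).trace.re) := by
  obtain ⟨c, hc, hA⟩ := schurOp_conj_geoMean h hX hY
  set g := (geoMean α X (schurOnSupp X Y)).trace.re
  have hpos : ∀ᶠ ε : ℝ in 𝓝[>] 0, 0 < ε := self_mem_nhdsWithin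
  rcases h with ⟨hα', rfl⟩ | ⟨hα', rfl⟩
  · set K := schurOp X Y
    have hR : (1 - K) * kerProj X = 1 - K := one_sub_schurOp_mul_kerProj hX hY
    have hQ := (isHermitian_kerProj hX.1).eq
    obtain ⟨d, hd, hd'⟩ := exists_trace_conj_le (1 - K)
    set C := d * (geoMean α 1 (kerBlock X Y)).trace.re
    -- The triangle inequality is used with δ = ε^γ. The factor 1 + δ tends to 1, and (1 + δ⁻¹)
    -- ε^(1-α) = ε^(1-α) + ε^γ still vanishes.
    set γ := (1 - α) / 2 with hγ
    have hγ0 : 0 < γ := by rw [hγ]; linarith [hα'.2]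
    have hlim : Tendsto (fun ε : ℝ => (1 + ε ^ γ) * ((1 + c * ε) ^ (1 - α) * g) +
        (ε ^ (1 - α) + ε ^ γ) * C) (𝓝[>] 0) (𝓝 g) := by
      have h1 := ((tendsto_const_nhds (x := (1 : ℝ))).add (tendsto_rpow_nhdsGT_zero hγ0)).mul
        ((tendsto_one_add_mul_rpow c (1 - α)).mul_const g)
      have h2 := ((tendsto_rpow_nhdsGT_zero (p := 1 - α) (by linarith [hα'.2])).add
        (tendsto_rpow_nhdsGT_zero hγ0)).mul_const C
      simpa using h1.add h2
    refine tendsto_of_tendsto_of_tendsto_of_le_of_le' tendsto_const_nhds hlim ?_ ?_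
    · filter_upwards [hpos] with ε hε
      exact trace_re_mono (signedLE_one.1
        (geoMean_schur_signedLE (Or.inl ⟨hα', rfl⟩) hX hY hα hε))
    · filter_upwards [hpos] with ε hε
      set G := geoMean α (X + ε • 1) Y
      have hG : G.PosSemidef := hY.posSemidef_geoMean _ _
      have h1 : (K * G * Kᴴ).trace.re ≤ (1 + c * ε) ^ (1 - α) * g := by
        simpa using (hA ε hε).trace_le
      have h2 : ((1 - K) * G * (1 - K)ᴴ).trace.re ≤ ε ^ (1 - α) * C := by
        have e : (1 - K) * G * (1 - K)ᴴ =
            (1 - K) * (kerProj X * G * kerProj X) * (1 - K)ᴴ := by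
          have : kerProj X * (1 - K)ᴴ = (1 - K)ᴴ := by
            simpa only [conjTranspose_mul, hQ] using congrArg conjTranspose hR
          rw [← Matrix.mul_assoc, ← Matrix.mul_assoc, hR, Matrix.mul_assoc _ (kerProj X), this]
        have hpsd : (kerProj X * G * kerProj X).PosSemidef := by
          have := hG.mul_mul_conjTranspose_same (kerProj X)
          rwa [hQ] at this
        have h3 := (kerProj_conj_geoMean (Or.inl ⟨hα', rfl⟩) hX hY hε).trace_le
        rw [one_mul, one_mul, trace_smul, Complex.smul_re, smul_eq_mul] at h3
        rw [e]
        refine (hd' _ hpsd).trans ((mul_le_mul_of_nonneg_left h3 hd.le).trans (le_of_eq ?_))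
        simp only [C]
        ring
      have h3 := hG.trace_le_of_add_eq_one (K := K) (R := 1 - K) (by abel)
        (Real.rpow_pos_of_pos hε γ)
      have hε1 : (1 + (ε ^ γ)⁻¹) * ε ^ (1 - α) = ε ^ (1 - α) + ε ^ γ := by
        have : ε ^ (1 - α) = ε ^ γ * ε ^ γ := by
          rw [← Real.rpow_add hε, hγ]; ring_nf
        have h0 := (Real.rpow_pos_of_pos hε γ).ne'
        rw [this]
        field_simp
      refine h3.trans (add_le_add (mul_le_mul_of_nonneg_left h1 (by positivity)) ?_)
      rw [← hε1, mul_assoc (1 + (ε ^ γ)⁻¹)]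
      exact mul_le_mul_of_nonneg_left h2 (by positivity)
  · have hS : Y * suppProj X = Y := hα.resolve_left hα'.1.not_gt
    -- With nested supports there is no off-diagonal block, and compressing by a projection can only
    -- lower the trace.
    have hK : schurOp X Y = suppProj X := by
      rw [schurOp, Matrix.mul_assoc (suppProj X), mul_kerProj_eq_zero_iff.2 hS]
      simp
    have hP := isHermitian_suppProj hX.1
    have hlim : Tendsto (fun ε : ℝ => (1 + c * ε) ^ (1 - α) * g) (𝓝[>] 0) (𝓝 g) := by
      simpa using (tendsto_one_add_mul_rpow c (1 - α)).mul_const g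
    refine tendsto_of_tendsto_of_tendsto_of_le_of_le' hlim tendsto_const_nhds ?_ ?_
    · filter_upwards [hpos] with ε hε
      have h1 := (hA ε hε).trace_le
      rw [hK, hP.eq, trace_smul, Complex.smul_re, smul_eq_mul] at h1
      have h2 := PosSemidef.trace_proj_conj_le hP (suppProj_mul_self hX.1)
        (suppProj_le_one hX.1) (hY.posSemidef_geoMean α (X + ε • 1))
      linarith
    · filter_upwards [hpos] with ε hε
      exact trace_re_mono (signedLE_neg_one.1
        (geoMean_schur_signedLE (Or.inr ⟨hα', rfl⟩) hX hY hα hε))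

/-- When the supports are not nested, Y has a nonzero block on ker X, whose contribution is at least
a positive multiple of ε^(1-α). -/
theorem tendsto_trace_geoMean_atTop (hα : α ∈ Ioc (1 : ℝ) 2) (hX : X.PosSemidef)
    (hY : Y.PosSemidef) (hS : Y * suppProj X ≠ Y) :
    Tendsto (fun ε : ℝ => (geoMean α (X + ε • 1) Y).trace.re) (𝓝[>] 0) atTop := by
  have hQ := isHermitian_kerProj hX.1
  have hD : kerBlock X Y ≠ 0 := fun h0 => hS <| mul_kerProj_eq_zero_iff.1 <|
    hY.mul_eq_zero_of_conj (by rw [hQ.eq]; exact h0)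
  have hpos := geoMean_one_left_trace_pos (hX.posSemidef_kerBlock hY) hD
    (lt_trans one_pos hα.1)
  refine tendsto_atTop_mono' _ ?_
    ((tendsto_rpow_neg_nhdsGT_zero (y := 1 - α) (by linarith [hα.1])).atTop_mul_const hpos)
  filter_upwards [self_mem_nhdsWithin] with ε hε
  have h1 := (kerProj_conj_geoMean (Or.inr ⟨hα, rfl⟩) hX hY hε).trace_le
  rw [trace_smul, Complex.smul_re, smul_eq_mul] at h1
  have h2 := PosSemidef.trace_proj_conj_le hQ (kerProj_mul_self hX.1)
    (kerProj_le_one hX.1) (hY.posSemidef_geoMean α (X + ε • 1))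
  linarith

/-- Congruence by a left-invertible operator, up to regularization. -/
lemma geoMean_conj_leftInverse {m : Type*} [Fintype m] [DecidableEq m]
    (h : IsExponentSign α s) (hX : X.PosSemidef) (hY : Y.PosSemidef) {K : Matrix m n ℂ}
    {L : Matrix n m ℂ} (hLK : L * K = 1) :
    ∃ c : ℝ, 0 < c ∧ ∀ ε : ℝ, 0 < ε →
      SignedLE s (L * geoMean α (K * X * Kᴴ + ε • 1) (K * Y * Kᴴ) * Lᴴ)
        (geoMean α (X + (c * ε) • 1) Y) := by
  obtain ⟨c, hc, h₁⟩ := exists_pos_le_smul_one (isHermitian_mul_conjTranspose_self L)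
  refine ⟨c, hc, fun ε hε => ?_⟩
  have hXε := (hX.mul_mul_conjTranspose_same K).posDef_add_smul_one hε
  have hconj (Z : Matrix n n ℂ) : L * (K * Z * Kᴴ) * Lᴴ = Z := by
    have : L * (K * Z * Kᴴ) * Lᴴ = (L * K) * Z * (L * K)ᴴ := by
      simp only [conjTranspose_mul, Matrix.mul_assoc]
    rw [this, hLK]
    simp
  have := geoMean_transformer_single h hXε.posSemidef (hY.mul_mul_conjTranspose_same K)
    (by rw [hXε.suppProj_eq_one, Matrix.mul_one])
    (hX.posDef_add_smul_one (ε := c * ε) (by positivity)) L (by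
      rw [Matrix.mul_add, Matrix.add_mul, hconj, Matrix.mul_smul, Matrix.mul_one,
        Matrix.smul_mul, mul_comm, mul_smul]
      exact add_le_add_right (real_smul_le h₁ hε.le) X)
  rwa [hconj] at this

/-- Monotonicity in the first argument makes the regularized quantity monotone in ε, so the defining
limit exists. -/
lemma geoMean_signedLE_of_le (h : IsExponentSign α s) {X' : Matrix n n ℂ} (hX : X.PosDef)
    (hX' : X'.PosDef) (hXX' : X ≤ X') (hY : Y.PosSemidef) :
    SignedLE s (geoMean α X Y) (geoMean α X' Y) := by
  simpa using geoMean_transformer_single h hX.posSemidef hY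
    (by rw [hX.suppProj_eq_one, Matrix.mul_one]) hX' 1 (by simpa using hXX')

end Limits

/-! ### Extreme eigenvalues as optima over states. -/

section Spectrum

variable {n : Type*} [Fintype n] [DecidableEq n] {T : Matrix n n ℂ}

lemma trace_mul_re_mono {F A B : Matrix n n ℂ} (hF : F.PosSemidef) (h : A ≤ B) :
    (F * A).trace.re ≤ (F * B).trace.re := by
  have h1 := trace_re_mono (conj_le h (matPow F (1 / 2)))
  have e (Z : Matrix n n ℂ) : (matPow F (1 / 2) * Z * (matPow F (1 / 2))ᴴ).trace =
      (F * Z).trace := by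
    rw [(isHermitian_matPow _ _).eq, trace_mul_comm, ← Matrix.mul_assoc, hF.half_mul_half]
  rwa [e, e] at h1

/-- The state is the rank-one projection onto a unit eigenvector. -/
lemma exists_isState_trace_eq (hT : T.IsHermitian) {x : ℝ} (hx : x ∈ spectrum ℝ T) :
    ∃ F : Matrix n n ℂ, IsState F ∧ (F * T).trace.re = x := by
  rw [hT.spectrum_real_eq_range_eigenvalues] at hx
  obtain ⟨j, rfl⟩ := hx
  set φ : n → ℂ := ⇑(hT.eigenvectorBasis j)
  have hφ : φ ⬝ᵥ star φ = 1 := by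
    have := hT.eigenvectorBasis.orthonormal.1 j
    rw [dotProduct_comm]
    have h2 : inner ℂ (hT.eigenvectorBasis j) (hT.eigenvectorBasis j) = (1 : ℂ) := by
      rw [inner_self_eq_norm_sq_to_K, this]; simp
    rw [EuclideanSpace.inner_eq_star_dotProduct] at h2
    rwa [dotProduct_comm] at h2
  refine ⟨vecMulVec φ (star φ), ⟨posSemidef_vecMulVec_self_star φ, ?_⟩, ?_⟩
  · rw [trace_vecMulVec, hφ]
  · rw [trace_mul_comm, mul_vecMulVec, trace_vecMulVec, hT.mulVec_eigenvectorBasis,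
      smul_dotProduct, hφ]
    simp

lemma minEigenvalue_mem_spectrum [Nonempty n] (hT : T.IsHermitian) :
    minEigenvalue T ∈ spectrum ℝ T := by
  refine Set.Nonempty.csInf_mem ?_ T.finite_real_spectrum
  rw [hT.spectrum_real_eq_range_eigenvalues]
  exact range_nonempty _

lemma minEigenvalue_smul_one_le (hT : T.IsHermitian) :
    minEigenvalue T • (1 : Matrix n n ℂ) ≤ T := by
  have h := cfc_mono (a := T) (g := fun x : ℝ => x) (f := fun _ : ℝ => minEigenvalue T)
    (fun x hx => csInf_le T.finite_real_spectrum.bddBelow hx) (continuousOn_spectrum T _)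
    (continuousOn_spectrum T _)
  rwa [hT.cfc_self, cfc_const _ T hT.isSelfAdjoint, Algebra.algebraMap_eq_smul_one] at h

open scoped Matrix.Norms.L2Operator in
lemma PosSemidef.isGreatest_opNormInf [Nonempty n] (hT : T.PosSemidef) :
    IsGreatest (spectrum ℝ T) (opNormInf T) := by
  have h := IsometricContinuousFunctionalCalculus.isGreatest_norm_spectrum (𝕜 := ℝ) T
    hT.1.isSelfAdjoint
  have hn : ‖T‖ = opNormInf T := l2_opNorm_def T
  rw [hn] at h
  obtain ⟨⟨x, hx, hx'⟩, h2⟩ := h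
  have hx0 := hT.spectrum_nonneg hx
  replace hx' : x = opNormInf T := (Real.norm_of_nonneg hx0).symm.trans hx'
  refine ⟨hx' ▸ hx, fun y hy => ?_⟩
  exact (Real.le_norm_self y).trans (h2 ⟨y, hy, rfl⟩)

lemma PosSemidef.le_opNormInf_smul_one [Nonempty n] (hT : T.PosSemidef) :
    T ≤ opNormInf T • (1 : Matrix n n ℂ) := by
  have h := cfc_mono (a := T) (f := fun x : ℝ => x) (g := fun _ : ℝ => opNormInf T)
    (fun x hx => hT.isGreatest_opNormInf.2 hx) (continuousOn_spectrum T _)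
    (continuousOn_spectrum T _)
  rwa [hT.1.cfc_self, cfc_const _ T hT.1.isSelfAdjoint, Algebra.algebraMap_eq_smul_one] at h

lemma _root_.IsState.trace_mul_smul_one {F : Matrix n n ℂ} (hF : IsState F) (c : ℝ) :
    (F * (c • (1 : Matrix n n ℂ))).trace.re = c := by
  simp [hF.2, trace_smul]

lemma _root_.IsState.minEigenvalue_le {F : Matrix n n ℂ} (hF : IsState F) (hT : T.IsHermitian) :
    minEigenvalue T ≤ (F * T).trace.re := by
  have := trace_mul_re_mono hF.1 (minEigenvalue_smul_one_le hT)
  rwa [hF.trace_mul_smul_one] at this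

lemma _root_.IsState.le_opNormInf [Nonempty n] {F : Matrix n n ℂ} (hF : IsState F)
    (hT : T.PosSemidef) : (F * T).trace.re ≤ opNormInf T := by
  have := trace_mul_re_mono hF.1 hT.le_opNormInf_smul_one
  rwa [hF.trace_mul_smul_one] at this

lemma PosSemidef.le_trace_smul_one [Nonempty n] (hT : T.PosSemidef) :
    T ≤ T.trace.re • (1 : Matrix n n ℂ) := by
  refine hT.le_opNormInf_smul_one.trans (real_smul_le_smul PosSemidef.one ?_)
  have h := hT.isGreatest_opNormInf.1
  rw [hT.1.spectrum_real_eq_range_eigenvalues] at h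
  obtain ⟨j, hj⟩ := h
  rw [← hj, hT.1.trace_eq_sum_eigenvalues, Complex.re_sum]
  exact Finset.single_le_sum (f := fun i => ((hT.1.eigenvalues i : ℂ)).re)
    (fun i _ => hT.eigenvalues_nonneg i) (Finset.mem_univ j)

/-- The minimum eigenvalue is monotone, with at most linear growth along the identity. -/
lemma minEigenvalue_sub_le [Nonempty n] {T' : Matrix n n ℂ} (hT : T.IsHermitian)
    (hT' : T'.IsHermitian)
    {c : ℝ} (h : T' ≤ T + c • 1) : minEigenvalue T' ≤ minEigenvalue T + c := by
  obtain ⟨F, hF, hFT⟩ := exists_isState_trace_eq hT (minEigenvalue_mem_spectrum hT)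
  refine (hF.minEigenvalue_le hT').trans ((trace_mul_re_mono hF.1 h).trans ?_)
  rw [Matrix.mul_add, trace_add, Complex.add_re, hFT, hF.trace_mul_smul_one]

end Spectrum

/-! ### Partial trace, Choi operators and channel outputs. -/

section Bipartite

variable {R A B κ : Type*} [Fintype B]

lemma partialTraceRight_eq_sum (G : Matrix (A × B) (A × B) ℂ) :
    partialTraceRight G = ∑ b, G.submatrix (fun a => (a, b)) (fun a => (a, b)) := by
  ext a a'
  simp [partialTraceRight, sum_apply]

lemma PosSemidef.posSemidef_partialTraceRight {G : Matrix (A × B) (A × B) ℂ} (hG : G.PosSemidef) :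
    (partialTraceRight G).PosSemidef := by
  rw [partialTraceRight_eq_sum]
  exact posSemidef_sum _ fun b _ => hG.submatrix _

lemma partialTraceRight_sub (G G' : Matrix (A × B) (A × B) ℂ) :
    partialTraceRight (G - G') = partialTraceRight G - partialTraceRight G' := by
  ext a a'
  simp [partialTraceRight]

lemma trace_partialTraceRight [Fintype A] (G : Matrix (A × B) (A × B) ℂ) :
    (partialTraceRight G).trace = G.trace := by
  simp [trace, partialTraceRight, Fintype.sum_prod_type]

lemma partialTraceRight_mono [Fintype A] {G G' : Matrix (A × B) (A × B) ℂ} (h : G ≤ G') :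
    partialTraceRight G ≤ partialTraceRight G' := by
  rw [le_iff, ← partialTraceRight_sub]
  exact PosSemidef.posSemidef_partialTraceRight h

lemma kronecker_one_conj_apply [Fintype A] [DecidableEq B] (Z : Matrix R A ℂ)
    (G : Matrix (A × B) (A × B) ℂ) (r r' : R)
    (b b' : B) : ((Z ⊗ₖ (1 : Matrix B B ℂ)) * G * (Z ⊗ₖ (1 : Matrix B B ℂ))ᴴ) (r, b) (r', b') =
      ∑ a, ∑ a', Z r a * G (a, b) (a', b') * star (Z r' a') := by
  simp only [mul_apply, Fintype.sum_prod_type, kroneckerMap_apply, conjTranspose_apply, one_apply,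
    mul_ite, mul_one, mul_zero, ite_mul, zero_mul, apply_ite star, star_zero,
    Finset.sum_ite_eq, Finset.mem_univ, if_true, Finset.sum_mul]
  rw [Finset.sum_comm]

/-- This is how an input enters only through Z†Z, paired with the partial trace. -/
lemma trace_kronecker_one_conj [Fintype R] [Fintype A] [DecidableEq B]
    (Z : Matrix R A ℂ) (G : Matrix (A × B) (A × B) ℂ) :
    ((Z ⊗ₖ (1 : Matrix B B ℂ)) * G * (Z ⊗ₖ (1 : Matrix B B ℂ))ᴴ).trace =
      (Zᴴ * Z * partialTraceRight G).trace := by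
  have h : partialTraceRight ((Z ⊗ₖ (1 : Matrix B B ℂ)) * G * (Z ⊗ₖ (1 : Matrix B B ℂ))ᴴ) =
      Z * partialTraceRight G * Zᴴ := by
    ext r r'
    simp_rw [partialTraceRight, of_apply, kronecker_one_conj_apply]
    simp only [mul_apply, of_apply, Finset.mul_sum,
      Finset.sum_mul, conjTranspose_apply]
    rw [Finset.sum_comm]
    conv_lhs => enter [2, a]; rw [Finset.sum_comm]
    rw [Finset.sum_comm]
  rw [← trace_partialTraceRight, h, trace_mul_comm, Matrix.mul_assoc]

variable [DecidableEq A] (N : Matrix A A ℂ →ₗ[ℂ] Matrix B B ℂ)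

omit [Fintype B] in
lemma choi_apply (a a' : A) (b b' : B) :
    choi N (a, b) (a', b') = N (single a a' 1) b b' := by
  have : (of fun x x' => vecMulVec (maxEntVec A) (star (maxEntVec A)) (a, x) (a', x')) =
      single a a' (1 : ℂ) := by
    ext x x'
    simp [vecMulVec_apply, maxEntVec, single_apply]
    split_ifs <;> simp_all
  simp only [choi, idTensor, of_apply, this]

omit [Fintype B] in
lemma apply_eq_sum_choi [Fintype A] (X : Matrix A A ℂ) (b b' : B) :
    N X b b' = ∑ a, ∑ a', X a a' * choi N (a, b) (a', b') := by
  conv_lhs => rw [matrix_eq_sum_single X]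
  simp only [map_sum, sum_apply, choi_apply]
  refine Finset.sum_congr rfl fun a _ => Finset.sum_congr rfl fun a' _ => ?_
  have : single a a' (X a a') = X a a' • single a a' (1 : ℂ) := by simp
  rw [this, map_smul, smul_apply, smul_eq_mul]

/-- The slice of a family of bipartite vectors, as operators from `A` to `R`. -/
def slice (C : Matrix (R × A) κ ℂ) (k : κ) : Matrix R A ℂ :=
  of fun r a => C (r, a) k

lemma idTensor_mul_conjTranspose [Fintype A] [DecidableEq B] [Fintype κ]
    (C : Matrix (R × A) κ ℂ) :
    idTensor N (C * Cᴴ) = ∑ k, (slice C k ⊗ₖ (1 : Matrix B B ℂ)) * choi N *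
      (slice C k ⊗ₖ (1 : Matrix B B ℂ))ᴴ := by
  ext ⟨r, b⟩ ⟨r', b'⟩
  simp_rw [sum_apply, kronecker_one_conj_apply]
  simp only [idTensor, of_apply, apply_eq_sum_choi N _ b b', slice, mul_apply,
    conjTranspose_apply, Finset.sum_mul]
  conv_lhs => enter [2, a]; rw [Finset.sum_comm]
  rw [Finset.sum_comm]
  refine Finset.sum_congr rfl fun k _ => Finset.sum_congr rfl fun a _ =>
    Finset.sum_congr rfl fun a' _ => by ring

omit [Fintype B] [DecidableEq A] in
lemma sum_slice_isState [Fintype R] [Fintype A] [Fintype κ]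
    {C : Matrix (R × A) κ ℂ} (hC : (C * Cᴴ).trace = 1) :
    IsState (∑ k, (slice C k)ᴴ * slice C k) := by
  refine ⟨posSemidef_sum _ fun k _ => posSemidef_conjTranspose_mul_self _, ?_⟩
  rw [← hC]
  rw [trace_sum]
  simp only [trace, diag_apply, mul_apply, conjTranspose_apply, slice, of_apply,
    Fintype.sum_prod_type]
  rw [Finset.sum_comm]
  conv_lhs => enter [2, a]; rw [Finset.sum_comm]
  rw [Finset.sum_comm]
  exact Finset.sum_congr rfl fun r _ => Finset.sum_congr rfl fun a _ =>
    Finset.sum_congr rfl fun k _ => mul_comm _ _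

/-- Complete positivity is stated for references `Fin k`, so the copy of A is relabelled by `Fin
(card A)` and back. -/
lemma posSemidef_choi [Fintype A] {N : Matrix A A ℂ →ₗ[ℂ] Matrix B B ℂ}
    (hN : IsCompletelyPositive N) :
    (choi N).PosSemidef := by
  let e := Fintype.equivFin A
  have h := hN (Fintype.card A)
    ((vecMulVec (maxEntVec A) (star (maxEntVec A))).submatrix
      (Prod.map e.symm id) (Prod.map e.symm id))
    ((posSemidef_vecMulVec_self_star _).submatrix _)
  have h2 := h.submatrix (Prod.map e id)
  convert h2 using 1
  ext ⟨a, b⟩ ⟨a', b'⟩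
  simp [choi, idTensor]

end Bipartite

end Matrix

open Matrix

/-! ### Existence of the limit defining the quasi-entropy. -/

section Quasi

variable {n : Type*} [Fintype n] [DecidableEq n] {ρ σ : Matrix n n ℂ} {α s : ℝ}

lemma geoRenyiQuasi_eq_limUnder (hσ : σ.PosSemidef) :
    geoRenyiQuasi α ρ σ = limUnder (𝓝[>] (0 : ℝ)) fun ε =>
      ENNReal.ofReal (geoMean α (σ + ε • 1) ρ).trace.re := by
  rw [geoRenyiQuasi, limUnder, limUnder]
  congr 1
  refine Filter.map_congr ?_
  filter_upwards [self_mem_nhdsWithin] with ε hε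
  have hσε := (hσ.posDef_add_smul_one hε).posSemidef
  rw [Complex.coe_smul, geoMean, trace_mul_comm (matPow _ (1 / 2) * _), ← Matrix.mul_assoc,
    hσε.half_mul_half]

lemma tendsto_geoRenyiQuasi (h : IsExponentSign α s) (hσ : σ.PosSemidef) (hρ : ρ.PosSemidef) :
    Tendsto (fun ε : ℝ => ENNReal.ofReal (geoMean α (σ + ε • 1) ρ).trace.re) (𝓝[>] 0)
      (𝓝 (geoRenyiQuasi α ρ σ)) := by
  rw [geoRenyiQuasi_eq_limUnder hσ]
  refine tendsto_nhds_limUnder ?_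
  have hmono {ε ε' : ℝ} (hε : 0 < ε) (hεε' : ε ≤ ε') :=
    (geoMean_signedLE_of_le h (hσ.posDef_add_smul_one hε)
      (hσ.posDef_add_smul_one (hε.trans_le hεε'))
      (add_le_add_right (real_smul_le_smul PosSemidef.one hεε') σ) hρ).trace_le
  rcases h with ⟨-, rfl⟩ | ⟨-, rfl⟩
  · refine ⟨_, MonotoneOn.tendsto_nhdsGT (fun ε hε ε' _ hεε' => ?_) (OrderBot.bddBelow _)⟩
    exact ENNReal.ofReal_le_ofReal (by simpa using hmono hε hεε')
  · refine ⟨_, AntitoneOn.tendsto_nhdsGT (fun ε hε ε' _ hεε' => ?_) (OrderTop.bddAbove _)⟩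
    exact ENNReal.ofReal_le_ofReal (by simpa using hmono hε hεε')

end Quasi

/-! ### The logarithm scaled by 1/(α - 1). -/

section ScaledLog

/-- The map `q ↦ (α - 1)⁻¹ ln q` on `[0, ∞]`. -/
noncomputable def scaledLog (α : ℝ) (q : ℝ≥0∞) : EReal :=
  (((α - 1)⁻¹ : ℝ) : EReal) * ENNReal.log q

variable {α s : ℝ}

lemma tendsto_scaledLog (α : ℝ) {β : Type*} {l : Filter β}
    {f : β → ℝ≥0∞} {q : ℝ≥0∞} (hf : Tendsto f l (𝓝 q)) :
    Tendsto (fun x => scaledLog α (f x)) l (𝓝 (scaledLog α q)) := by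
  exact EReal.Tendsto.const_mul ((ENNReal.continuous_log.tendsto q).comp hf)
    (Or.inl (EReal.coe_ne_bot _)) (Or.inl (EReal.coe_ne_top _))

/-- The scaled logarithm decreases for α < 1 and increases for α > 1, which cancels the sign s and
gives one direction for both ranges. -/
lemma scaledLog_le_of_tendsto (h : Matrix.IsExponentSign α s) {β : Type*} {l : Filter β} [l.NeBot]
    {f g : β → ℝ} {a b : ℝ≥0∞} (hfg : ∀ᶠ x in l, s * f x ≤ s * g x)
    (hf : Tendsto (fun x => ENNReal.ofReal (f x)) l (𝓝 a))
    (hg : Tendsto (fun x => ENNReal.ofReal (g x)) l (𝓝 b)) :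
    scaledLog α b ≤ scaledLog α a := by
  rcases h with ⟨hα, rfl⟩ | ⟨hα, rfl⟩
  · have hab : a ≤ b := le_of_tendsto_of_tendsto hf hg <| by
      filter_upwards [hfg] with x hx
      exact ENNReal.ofReal_le_ofReal (by simpa using hx)
    have hc : 0 ≤ (((-(α - 1)⁻¹) : ℝ) : EReal) := by
      have : (α - 1)⁻¹ ≤ 0 := inv_nonpos.2 (by linarith [hα.2])
      exact_mod_cast neg_nonneg.2 this
    have := mul_le_mul_of_nonneg_left (ENNReal.log_monotone hab) hc
    rw [EReal.coe_neg, EReal.neg_mul, EReal.neg_mul, EReal.neg_le_neg_iff] at this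
    exact this
  · have hab : b ≤ a := le_of_tendsto_of_tendsto hg hf <| by
      filter_upwards [hfg] with x hx
      exact ENNReal.ofReal_le_ofReal (by simpa using hx)
    have hc : 0 ≤ (((α - 1)⁻¹ : ℝ) : EReal) := by
      have : 0 ≤ (α - 1)⁻¹ := inv_nonneg.2 (by linarith [hα.1])
      exact_mod_cast this
    exact mul_le_mul_of_nonneg_left (ENNReal.log_monotone hab) hc

lemma geoRenyi_eq_scaledLog {n : Type*} [Fintype n] [DecidableEq n] (α : ℝ)
    (ρ σ : Matrix n n ℂ) : geoRenyi α ρ σ = scaledLog α (geoRenyiQuasi α ρ σ) := rfl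

end ScaledLog

/-! ### Upper and lower bounds for the channel divergence. -/

section Channels

variable {A B : Type*} [Fintype A] [DecidableEq A] [Fintype B] [DecidableEq B]
  {N M : Matrix A A ℂ →ₗ[ℂ] Matrix B B ℂ} {α s : ℝ}

/-- The operator `Tr_B G_α(Γ^M, Γ̃^N)` on the reference system. -/
noncomputable def choiMean (α : ℝ) (N M : Matrix A A ℂ →ₗ[ℂ] Matrix B B ℂ) : Matrix A A ℂ :=
  partialTraceRight (geoMean α (choi M) (schurOnSupp (choi M) (choi N)))

/-- A bound for `Tr[F Tr_B G_α]` over all input states `F` bounds the geometric Rényi relative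
entropy of the channel outputs. -/
lemma geoRenyi_le_scaledLog (h : Matrix.IsExponentSign α s) (hN : IsCompletelyPositive N)
    (hM : IsCompletelyPositive M)
    (hα : α < 1 ∨ choi N * suppProj (choi M) = choi N) {e : ℝ}
    (he : ∀ F : Matrix A A ℂ, IsState F → s * e ≤ s * (F * choiMean α N M).trace.re)
    {R : Type*} [Fintype R] [DecidableEq R] {ρ : Matrix (R × A) (R × A) ℂ} (hρ : IsState ρ) :
    geoRenyi α (idTensor N ρ) (idTensor M ρ) ≤ scaledLog α (ENNReal.ofReal e) := by
  have hX := posSemidef_choi hM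
  have hY := posSemidef_choi hN
  -- Any factorization ρ = C C† would do. Its columns give the operators Z_k, and hence the
  -- transformer inequality applies to mixed inputs directly, without purification.
  set C := matPow ρ (1 / 2)
  have hC : C * Cᴴ = ρ := by
    rw [(isHermitian_matPow _ _).eq, hρ.1.half_mul_half]
  have hF := sum_slice_isState (C := C) (by rw [hC, hρ.2])
  have hσ := idTensor_mul_conjTranspose M C
  have hρ' := idTensor_mul_conjTranspose N C
  rw [hC] at hσ hρ'
  have hσpsd : (idTensor M ρ).PosSemidef := by
    rw [hσ]
    exact posSemidef_sum _ fun k _ => hX.mul_mul_conjTranspose_same _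
  have hρpsd : (idTensor N ρ).PosSemidef := by
    rw [hρ']
    exact posSemidef_sum _ fun k _ => hY.mul_mul_conjTranspose_same _
  rw [geoRenyi_eq_scaledLog]
  refine scaledLog_le_of_tendsto h ?_ tendsto_const_nhds (tendsto_geoRenyiQuasi h hσpsd hρpsd)
  filter_upwards [self_mem_nhdsWithin] with ε hε
  have h1 := (geoMean_schur_transformer h hX hY hα (hσpsd.posDef_add_smul_one hε)
    (fun k => slice C k ⊗ₖ (1 : Matrix B B ℂ)) (by
      rw [← hσ, le_iff, add_sub_cancel_left]
      exact PosSemidef.one.real_smul (le_of_lt hε))).trace_le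
  rw [← hρ', trace_sum] at h1
  simp only [trace_kronecker_one_conj] at h1
  rw [← trace_sum, ← Finset.sum_mul] at h1
  exact (he _ hF).trans h1

/-- A positive definite input state `F` is the marginal of a pure state `(Z ⊗ 1)|Γ⟩` with `Z`
invertible. -/
lemma exists_pure_state {F : Matrix A A ℂ} (hF : F.PosDef) (hFs : IsState F)
    (N M : Matrix A A ℂ →ₗ[ℂ] Matrix B B ℂ) :
    ∃ (ρ : Matrix (Fin (Fintype.card A) × A) (Fin (Fintype.card A) × A) ℂ)
      (Z : Matrix (Fin (Fintype.card A)) A ℂ) (Z' : Matrix A (Fin (Fintype.card A)) ℂ),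
      IsState ρ ∧ Zᴴ * Z = F ∧ Z' * Z = 1 ∧ Z * Z' = 1 ∧
      idTensor N ρ = (Z ⊗ₖ (1 : Matrix B B ℂ)) * choi N * (Z ⊗ₖ (1 : Matrix B B ℂ))ᴴ ∧
      idTensor M ρ = (Z ⊗ₖ (1 : Matrix B B ℂ)) * choi M * (Z ⊗ₖ (1 : Matrix B B ℂ))ᴴ := by
  let e := Fintype.equivFin A
  have hFp := hF.posSemidef
  set W := matPow F (1 / 2)
  set W' := matPow F (-(1 / 2))
  have hW : Wᴴ = W := isHermitian_matPow _ _
  let Z : Matrix (Fin (Fintype.card A)) A ℂ := W.submatrix e.symm id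
  let Z' : Matrix A (Fin (Fintype.card A)) ℂ := W'.submatrix id e.symm
  let C : Matrix (Fin (Fintype.card A) × A) Unit ℂ := of fun p _ => Z p.1 p.2
  have hsl (k : Unit) : slice C k = Z := rfl
  have hZZ : Zᴴ * Z = F := by
    rw [conjTranspose_submatrix, hW, submatrix_mul_equiv, hFp.half_mul_half, submatrix_id_id]
  refine ⟨C * Cᴴ, Z, Z', ⟨posSemidef_self_mul_conjTranspose C, ?_⟩, hZZ, ?_, ?_, ?_, ?_⟩
  · rw [← hFs.2, ← hZZ]
    simp only [trace, diag_apply, mul_apply, conjTranspose_apply, C, of_apply,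
      Fintype.sum_prod_type, Finset.univ_unique, Finset.sum_singleton]
    rw [Finset.sum_comm]
    exact Finset.sum_congr rfl fun _ _ => Finset.sum_congr rfl fun _ _ => mul_comm _ _
  · rw [submatrix_mul_equiv, hFp.neg_half_mul_half, hF.suppProj_eq_one, submatrix_id_id]
  · have := submatrix_mul_equiv W W' e.symm (Equiv.refl A) e.symm
    simp only [Equiv.coe_refl] at this
    rw [this, hFp.half_mul_neg_half, hF.suppProj_eq_one, submatrix_one_equiv]
  · simp [idTensor_mul_conjTranspose, hsl]
  · simp [idTensor_mul_conjTranspose, hsl]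

/-- The difference from the limit is semidefinite with sign s, so its trace dominates the trace of
any congruence up to a constant. Trace convergence is therefore enough. -/
lemma tendsto_trace_conj_geoMean {n m : Type*} [Fintype n] [DecidableEq n] [Fintype m]
    {X Y : Matrix n n ℂ} (h : Matrix.IsExponentSign α s) (hX : X.PosSemidef)
    (hY : Y.PosSemidef) (hα : α < 1 ∨ Y * suppProj X = Y) (K : Matrix m n ℂ) :
    Tendsto (fun ε : ℝ => (K * geoMean α (X + ε • 1) Y * Kᴴ).trace.re) (𝓝[>] 0)
      (𝓝 (K * geoMean α X (schurOnSupp X Y) * Kᴴ).trace.re) := by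
  obtain ⟨c, hc, hK⟩ := exists_trace_conj_le K
  have h1 := tendsto_trace_geoMean h hX hY hα
  set G := geoMean α X (schurOnSupp X Y)
  have hss : s * s = 1 := by rcases h with ⟨-, rfl⟩ | ⟨-, rfl⟩ <;> norm_num
  rw [tendsto_iff_dist_tendsto_zero] at h1 ⊢
  refine squeeze_zero' (Eventually.of_forall fun _ => dist_nonneg) ?_
    (by simpa using h1.const_mul c)
  filter_upwards [self_mem_nhdsWithin] with ε hε
  have hD : (s • (geoMean α (X + ε • 1) Y - G)).PosSemidef :=
    geoMean_schur_signedLE h hX hY hα hε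
  have h2 := hK _ hD
  have h3 := hD.trace_re_nonneg
  have h4 := (hD.mul_mul_conjTranspose_same K).trace_re_nonneg
  simp only [Matrix.mul_smul, Matrix.smul_mul, Matrix.mul_sub, Matrix.sub_mul, trace_smul,
    trace_sub, Complex.smul_re, Complex.sub_re, smul_eq_mul] at h2 h3 h4
  have habs (x : ℝ) (hx : 0 ≤ s * x) : |x| = s * x := by
    have hs : |s| = 1 := by
      have := abs_mul_abs_self s
      rw [hss] at this
      nlinarith [abs_nonneg s]
    rw [← abs_of_nonneg hx, abs_mul, hs, one_mul]
  rw [Real.dist_eq, Real.dist_eq, habs _ h4, habs _ h3]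
  exact h2

/-- For the pure input with marginal F, Z is invertible, so the transformer inequality for Z⁻¹ ⊗ 1
bounds the regularized output mean by the conjugated Choi mean, at the rescaled parameter cε. -/
lemma exists_scaledLog_le_geoRenyi (h : Matrix.IsExponentSign α s) (hN : IsCompletelyPositive N)
    (hM : IsCompletelyPositive M)
    (hα : α < 1 ∨ choi N * suppProj (choi M) = choi N) {F : Matrix A A ℂ} (hF : F.PosDef)
    (hFs : IsState F) :
    scaledLog α (ENNReal.ofReal (F * choiMean α N M).trace.re) ≤ geoRenyiChannel α N M := by
  obtain ⟨ρ, Z, Z', hρ, hZZ, hZ'Z, hZZ', hρN, hρM⟩ := exists_pure_state hF hFs N M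
  have hX := posSemidef_choi hM
  have hY := posSemidef_choi hN
  refine le_trans ?_ (le_iSup_of_le _ (le_iSup_of_le ρ (le_iSup_of_le hρ le_rfl)))
  rw [geoRenyi_eq_scaledLog, hρN, hρM]
  set K := Z ⊗ₖ (1 : Matrix B B ℂ)
  set L := Z' ⊗ₖ (1 : Matrix B B ℂ)
  have hLK : L * K = 1 := by
    rw [← mul_kronecker_mul, hZ'Z, Matrix.mul_one, one_kronecker_one]
  have hKL : K * L = 1 := by
    rw [← mul_kronecker_mul, hZZ', Matrix.mul_one, one_kronecker_one]
  obtain ⟨c, hc, hcL⟩ := geoMean_conj_leftInverse h hX hY hLK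
  have hscale : Tendsto (fun ε : ℝ => c * ε) (𝓝[>] 0) (𝓝[>] 0) := by
    refine tendsto_nhdsWithin_iff.2 ⟨?_, ?_⟩
    · simpa using ((continuous_const_mul c).tendsto 0).mono_left nhdsWithin_le_nhds
    · filter_upwards [self_mem_nhdsWithin] with ε hε using mul_pos hc hε
  refine scaledLog_le_of_tendsto h ?_ (tendsto_geoRenyiQuasi h
    (hX.mul_mul_conjTranspose_same K) (hY.mul_mul_conjTranspose_same K))
    (g := fun ε => (K * geoMean α (choi M + (c * ε) • 1) (choi N) * Kᴴ).trace.re) ?_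
  · filter_upwards [self_mem_nhdsWithin] with ε hε
    have h1 := ((hcL ε hε).conj K).trace_le
    have e (G : Matrix (Fin (Fintype.card A) × B) (Fin (Fintype.card A) × B) ℂ) :
        K * (L * G * Lᴴ) * Kᴴ = G := by
      have : K * (L * G * Lᴴ) * Kᴴ = (K * L) * G * (K * L)ᴴ := by
        simp only [conjTranspose_mul, Matrix.mul_assoc]
      rw [this, hKL]
      simp
    rwa [e] at h1
  · have h2 := (tendsto_trace_conj_geoMean h hX hY hα K).comp hscale
    rw [trace_kronecker_one_conj, hZZ] at h2
    exact (ENNReal.continuous_ofReal.tendsto _).comp h2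

lemma exists_posDef_isState [Nonempty A] : ∃ F : Matrix A A ℂ, F.PosDef ∧ IsState F := by
  have hd : (0 : ℝ) < Fintype.card A := by exact_mod_cast Fintype.card_pos
  have hpd : ((Fintype.card A : ℝ)⁻¹ • (1 : Matrix A A ℂ)).PosDef := by
    simpa using (PosSemidef.zero (n := A) (R := ℂ)).posDef_add_smul_one (inv_pos.2 hd)
  refine ⟨_, hpd, hpd.posSemidef, ?_⟩
  rw [trace_smul, trace_one, Complex.real_smul]
  have : (Fintype.card A : ℂ) ≠ 0 := by exact_mod_cast hd.ne'
  push_cast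
  exact inv_mul_cancel₀ this

lemma scaledLog_le_geoRenyiChannel [Nonempty A] (h : Matrix.IsExponentSign α s)
    (hN : IsCompletelyPositive N) (hM : IsCompletelyPositive M)
    (hα : α < 1 ∨ choi N * suppProj (choi M) = choi N) {F : Matrix A A ℂ} (hF : IsState F) :
    scaledLog α (ENNReal.ofReal (F * choiMean α N M).trace.re) ≤ geoRenyiChannel α N M := by
  obtain ⟨F₀, hF₀, hF₀s⟩ := exists_posDef_isState (A := A)
  -- A singular F is reached by mixing in the full-rank state F₀.
  have hlim : Tendsto (fun δ : ℝ => (((1 - δ) • F + δ • F₀) * choiMean α N M).trace.re)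
      (𝓝[>] 0) (𝓝 (F * choiMean α N M).trace.re) := by
    have hc : Continuous fun δ : ℝ => (1 - δ) * (F * choiMean α N M).trace.re +
        δ * (F₀ * choiMean α N M).trace.re := by fun_prop
    have := (hc.tendsto 0).mono_left (nhdsWithin_le_nhds (s := Ioi 0))
    simpa [Matrix.add_mul, trace_add, trace_smul] using this
  refine le_of_tendsto
    (tendsto_scaledLog α ((ENNReal.continuous_ofReal.tendsto _).comp hlim)) ?_
  filter_upwards [Ioo_mem_nhdsGT one_pos] with δ hδ
  have h1 : ((1 - δ) • F + δ • F₀).PosDef := by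
    refine PosDef.posSemidef_add (hF.1.real_smul (by linarith [hδ.2])) ?_
    have := hF₀.smul (a := (δ : ℂ)) (by exact_mod_cast hδ.1)
    simpa using this
  refine exists_scaledLog_le_geoRenyi h hN hM hα h1 ⟨h1.posSemidef, ?_⟩
  rw [trace_add, trace_smul, trace_smul, hF.2, hF₀s.2, ← add_smul, sub_add_cancel, one_smul]

theorem geoRenyiChannel_eq_scaledLog [Nonempty A] (h : Matrix.IsExponentSign α s)
    (hN : IsCompletelyPositive N) (hM : IsCompletelyPositive M)
    (hα : α < 1 ∨ choi N * suppProj (choi M) = choi N) {e : ℝ}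
    (he : ∀ F : Matrix A A ℂ, IsState F → s * e ≤ s * (F * choiMean α N M).trace.re)
    (he' : ∃ F : Matrix A A ℂ, IsState F ∧ (F * choiMean α N M).trace.re = e) :
    geoRenyiChannel α N M = scaledLog α (ENNReal.ofReal e) := by
  refine le_antisymm ?_ ?_
  · exact iSup_le fun r => iSup_le fun ρ => iSup_le fun hρ =>
      geoRenyi_le_scaledLog h hN hM hα he hρ
  · obtain ⟨F, hF, rfl⟩ := he'
    exact scaledLog_le_geoRenyiChannel h hN hM hα hF

theorem geoRenyiChannel_eq_top [Nonempty A] (hα : α ∈ Ioc (1 : ℝ) 2)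
    (hN : IsCompletelyPositive N) (hM : IsCompletelyPositive M)
    (hS : choi N * suppProj (choi M) ≠ choi N) :
    geoRenyiChannel α N M = scaledLog α ⊤ := by
  have h : Matrix.IsExponentSign α (-1) := Or.inr ⟨hα, rfl⟩
  have htop : scaledLog α ⊤ = ⊤ := by
    rw [scaledLog, ENNReal.log_top]
    exact EReal.coe_mul_top_of_pos (inv_pos.2 (by linarith [hα.1]))
  rw [htop, eq_top_iff, ← htop]
  obtain ⟨F, hF, hFs⟩ := exists_posDef_isState (A := A)
  obtain ⟨ρ, Z, Z', hρ, -, hZ'Z, -, hρN, hρM⟩ := exists_pure_state hF hFs N M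
  have hX := posSemidef_choi hM
  have hY := posSemidef_choi hN
  refine le_trans ?_ (le_iSup_of_le _ (le_iSup_of_le ρ (le_iSup_of_le hρ le_rfl)))
  rw [geoRenyi_eq_scaledLog, hρN, hρM]
  set K := Z ⊗ₖ (1 : Matrix B B ℂ)
  set L := Z' ⊗ₖ (1 : Matrix B B ℂ)
  have hLK : L * K = 1 := by
    rw [← mul_kronecker_mul, hZ'Z, Matrix.mul_one, one_kronecker_one]
  obtain ⟨c, hc, hcL⟩ := geoMean_conj_leftInverse h hX hY hLK
  obtain ⟨d, hd, hdL⟩ := exists_trace_conj_le L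
  have hscale : Tendsto (fun ε : ℝ => c * ε) (𝓝[>] 0) (𝓝[>] 0) := by
    refine tendsto_nhdsWithin_iff.2 ⟨?_, ?_⟩
    · simpa using ((continuous_const_mul c).tendsto 0).mono_left nhdsWithin_le_nhds
    · filter_upwards [self_mem_nhdsWithin] with ε hε using mul_pos hc hε
  -- The divergence at the level of Choi operators passes to the outputs: d times the output trace
  -- dominates the trace after congruence by L, which dominates the Choi trace at cε.
  have hinf := ((tendsto_trace_geoMean_atTop hα hX hY hS).comp hscale).const_mul_atTop
    (inv_pos.2 hd)
  refine scaledLog_le_of_tendsto h ?_ (tendsto_geoRenyiQuasi h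
    (hX.mul_mul_conjTranspose_same K) (hY.mul_mul_conjTranspose_same K))
    (ENNReal.tendsto_ofReal_atTop.comp hinf)
  filter_upwards [self_mem_nhdsWithin] with ε hε
  have h1 := (hcL ε hε).trace_le
  have h2 := hdL _ ((hY.mul_mul_conjTranspose_same K).posSemidef_geoMean α
    (K * choi M * Kᴴ + ε • 1))
  simp only [Function.comp_apply]
  have h3 := mul_le_mul_of_nonneg_left (show (geoMean α (choi M + (c * ε) • 1)
    (choi N)).trace.re ≤ d * _ by linarith) (inv_pos.2 hd).le
  rw [inv_mul_cancel_left₀ hd.ne'] at h3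
  linarith

end Channels

/-! ### The proposition. -/

theorem mainTheorem7 {A B : Type*} [Fintype A] [DecidableEq A] [Nonempty A]
    [Fintype B] [DecidableEq B]
    (N M : Matrix A A ℂ →ₗ[ℂ] Matrix B B ℂ)
    (hN : IsQuantumChannel N) (hM : IsQuantumChannel M)
    (α : ℝ) (hα : α ∈ Set.Ioo (0 : ℝ) 1 ∪ Set.Ioc (1 : ℝ) 2) :
    geoRenyiChannel α N M = (((α - 1)⁻¹ : ℝ) : EReal) * ENNReal.log (choiQuasi α N M) ∧
      (α < 1 →
        Tendsto
          (fun ε : ℝ => ((minEigenvalue (partialTraceRight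
            (geoMean α (choi M + (ε : ℂ) • 1) (choi N))) : ℝ) : EReal))
          (𝓝[>] (0 : ℝ)) (𝓝 ((choiQuasi α N M : ℝ≥0∞) : EReal))) := by
  have hX := posSemidef_choi hM.1
  have hY := posSemidef_choi hN.1
  have hT : (choiMean α N M).PosSemidef :=
    ((hX.posSemidef_schurOnSupp hY).posSemidef_geoMean _ _).posSemidef_partialTraceRight
  have hsupp := opSupp_le_opSupp_iff (Y := choi N) hX
  rcases hα with hα | hα
  · have h : Matrix.IsExponentSign α 1 := Or.inl ⟨hα, rfl⟩
    have hq : choiQuasi α N M = ENNReal.ofReal (minEigenvalue (choiMean α N M)) := by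
      rw [choiQuasi]
      split_ifs with h1 h2 h2
      · rw [choiMean, schurOnSupp_eq_self hX hY (hsupp.1 h1)]
      · exact absurd hα.2 h2
      · rfl
      · exact absurd hα.2 h2
    have hmem := minEigenvalue_mem_spectrum hT.1
    refine ⟨?_, fun _ => ?_⟩
    · rw [hq]
      exact geoRenyiChannel_eq_scaledLog h hN.1 hM.1 (Or.inl hα.2)
        (fun F hF => by simpa using hF.minEigenvalue_le hT.1) (exists_isState_trace_eq hT.1 hmem)
    · rw [hq, EReal.coe_ennreal_ofReal, max_eq_left (hT.spectrum_nonneg hmem)]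
      refine (continuous_coe_real_ereal.tendsto _).comp ?_
      have hlim := tendsto_trace_geoMean h hX hY (Or.inl hα.2)
      set G := geoMean α (choi M) (schurOnSupp (choi M) (choi N)) with hG
      -- The regularized mean lies above G, and its partial trace exceeds that of G by at most
      -- Tr(G_ε - G) times the identity. This squeezes the minimum eigenvalue.
      have hup : Tendsto (fun ε : ℝ => minEigenvalue (choiMean α N M) +
          ((geoMean α (choi M + ε • 1) (choi N)).trace.re - G.trace.re)) (𝓝[>] 0)
          (𝓝 (minEigenvalue (choiMean α N M))) := by
        simpa using (hlim.sub_const G.trace.re).const_add (minEigenvalue (choiMean α N M))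
      refine tendsto_of_tendsto_of_tendsto_of_le_of_le' tendsto_const_nhds hup ?_ ?_
      all_goals
        filter_upwards [self_mem_nhdsWithin] with ε hε
        have hle : G ≤ geoMean α (choi M + ε • 1) (choi N) :=
          signedLE_one.1 (geoMean_schur_signedLE h hX hY (Or.inl hα.2) hε)
        have hT' := (hY.posSemidef_geoMean α (choi M + ε • 1)).posSemidef_partialTraceRight
        rw [Complex.coe_smul]
      · have := minEigenvalue_sub_le (c := 0) hT'.1 hT.1
          (by simpa using! partialTraceRight_mono hle)
        simpa using this
      · refine minEigenvalue_sub_le hT.1 hT'.1 ?_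
        have hD := (PosSemidef.posSemidef_partialTraceRight hle).le_trace_smul_one
        rw [trace_partialTraceRight, partialTraceRight_sub, trace_sub, Complex.sub_re,
          sub_le_iff_le_add'] at hD
        exact hD
  · refine ⟨?_, fun h1 => absurd h1 hα.1.not_gt⟩
    have h : Matrix.IsExponentSign α (-1) := Or.inr ⟨hα, rfl⟩
    by_cases hS : choi N * suppProj (choi M) = choi N
    · have hq : choiQuasi α N M = ENNReal.ofReal (opNormInf (choiMean α N M)) := by
        rw [choiQuasi, if_pos (hsupp.2 hS), if_neg hα.1.not_gt, choiMean,
          schurOnSupp_eq_self hX hY hS]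
      rw [hq]
      exact geoRenyiChannel_eq_scaledLog h hN.1 hM.1 (Or.inr hS)
        (fun F hF => by simpa using hF.le_opNormInf hT)
        (exists_isState_trace_eq hT.1 hT.isGreatest_opNormInf.1)
    · rw [choiQuasi, if_neg (fun h1 => hS (hsupp.1 h1)), if_neg hα.1.not_gt]
      exact geoRenyiChannel_eq_top hα hN.1 hM.1 hS
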